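/- All algebras are unital and over $\mathbb{C}$, and all Hopf algebras are assumed to have bijective antipode. For a Hopf algebra map $p: A \to H$ write $A^{\mathrm{co}(H)} := \{a \in A : a_{(1)} \otimes p(a_{(2)}) = a \otimes 1\}$. For a Hopf algebra $H$ let $\Gamma_H$ be its group of grouplike elements, $\mathbb{C}\Gamma_H \subseteq H$ its group algebra (the linear span of $\Gamma_H$ in $H$), $K_H := H/\langle g - 1 \mid g \in \Gamma_H\rangle$ the quotient Hopf algebra by the indicated two-sided ideal, and $\mathrm{proj}_K : H \to K_H$ the canonical projection. A quantum homogeneous $A$-space is a left coideal subalgebra $B \subseteq A$ such that $A$ is faithfully flat as a right $B$-module (that is, $A \otimes_B -$ preserves and reflects exact sequences of left $B$-modules) and $B^+A = AB^+$, where $B^+ := B \cap \ker \varepsilon$; in that case $\pi_B : A \to \pi_B(A) := A/B^+A$ is a surjective Hopf algebra map. A principal $A$-pair is a pair $(B,P)$ of quantum homogeneous $A$-spaces $B \subseteq P$ such that $\pi_B(P) = \pi_B(A)^{\mathrm{co}(\pi_P(A))}$ and this is a Hopf subalgebra of $\pi_B(A)$; here the coinvariants are taken with respect to the map $\pi_B(A)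 \to \pi_P(A)$, $\pi_B(a) \mapsto \pi_P(a)$. Theorem. Let $A$ and $H$ be Hopf algebras and $\pi_H : A \to H$ a surjective Hopf algebra map. Assume that $H$ is cosemisimple (the direct sum of its simple subcoalgebras) and that every grouplike element of $H$ is central in $H$. Put $B := A^{\mathrm{co}(H)}$, with respect to $\pi_H$, and $P := A^{\mathrm{co}(K_H)}$, with respect to $\mathrm{proj}_K \circ \pi_H$. Then $$\pi_H(P) = H^{\mathrm{co}(K_H)} = \mathbb{C}\Gamma_H,$$ where the coinvariants in the middle are taken with respect to $\mathrm{proj}_K$. Moreover, $(B,P)$ is a principal $A$-pair. -/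

import Mathlib

open scoped TensorProduct

universe u v

namespace QHS

/-! ### Cosemisimple coalgebras -/

section Coalgebras

variable {k : Type*} {C : Type*} [Field k] [AddCommGroup C] [Module k C] [Coalgebra k C]

/-- A subspace `D` of a coalgebra with `Δ(D) ⊆ D ⊗ D`. -/
def IsSubcoalgebra (D : Submodule k C) : Prop :=
  ∀ x ∈ D, Coalgebra.comul (R := k) x ∈
    LinearMap.range (TensorProduct.map D.subtype D.subtype)

/-- A nonzero subcoalgebra whose only subcoalgebras are `0` and itself. -/
structure IsSimpleSubcoalgebra (D : Submodule k C) : Prop where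
  isSubcoalgebra : IsSubcoalgebra D
  ne_bot : D ≠ ⊥
  eq_bot_or_eq : ∀ E : Submodule k C, IsSubcoalgebra E → E ≤ D → E = ⊥ ∨ E = D

variable (k C) in
/-- A coalgebra is cosemisimple if it is the direct sum of its simple subcoalgebras
(the Peter–Weyl decomposition). -/
structure IsCosemisimple : Prop where
  indep : sSupIndep {D : Submodule k C | IsSimpleSubcoalgebra D}
  sSup_eq_top : sSup {D : Submodule k C | IsSimpleSubcoalgebra D} = ⊤

end Coalgebras

/-! ### Coinvariants, Hopf subalgebras -/

section Bialgebras

variable {k : Type*} [Field k]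

/-- The subalgebra `H^{co(K)} = {h | h₍₁₎ ⊗ p(h₍₂₎) = h ⊗ 1}` of right coinvariants of the coaction
`(id ⊗ p) ∘ Δ : H → H ⊗ K` attached to a bialgebra map `p : H → K`. -/
noncomputable def coinvariants {H K : Type*} [Ring H] [Bialgebra k H] [Ring K] [Bialgebra k K]
    (p : H →ₐc[k] K) : Subalgebra k H :=
  AlgHom.equalizer
    ((Algebra.TensorProduct.map (AlgHom.id k H) (p : H →ₐ[k] K)).comp (Bialgebra.comulAlgHom k H))
    (Algebra.TensorProduct.includeLeft : H →ₐ[k] H ⊗[k] K)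

/-- A subalgebra which is a subcoalgebra and closed under the antipode. -/
structure IsHopfSubalgebra {H : Type*} [Ring H] [HopfAlgebra k H] (D : Subalgebra k H) : Prop where
  isSubcoalgebra : IsSubcoalgebra (Subalgebra.toSubmodule D)
  antipode_mem : ∀ x ∈ D, HopfAlgebra.antipode k x ∈ D

end Bialgebras

/-! ### Faithful flatness over a noncommutative subalgebra -/

section FaithfullyFlat

variable {k : Type*} {A : Type u} [Field k] [Ring A] [Algebra k A] (B : Subalgebra k A)

section Tensor

variable (M : Type*) [AddCommGroup M] [Module k M] [Module B M]

/-- The subspace of `A ⊗ M` spanned by the elements `a b ⊗ m - a ⊗ b m` with `b ∈ B`. -/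
def balancingSubmodule : Submodule k (A ⊗[k] M) :=
  Submodule.span k {z | ∃ (a : A) (b : B) (m : M), z = (a * (b : A)) ⊗ₜ[k] m - a ⊗ₜ[k] (b • m)}

/-- The tensor product `A ⊗_B M` of the right `B`-module `A` with a left `B`-module `M`. -/
abbrev TensorOver : Type _ := (A ⊗[k] M) ⧸ balancingSubmodule B M

end Tensor

variable {M N : Type*} [AddCommGroup M] [Module k M] [Module B M] [IsScalarTower k B M]
  [AddCommGroup N] [Module k N] [Module B N] [IsScalarTower k B N]

/-- The functoriality `id ⊗ f : A ⊗_B M → A ⊗_B N` of `A ⊗_B -`. -/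
noncomputable def TensorOver.map (f : M →ₗ[B] N) : TensorOver B M →ₗ[k] TensorOver B N :=
  Submodule.mapQ _ _ ((f.restrictScalars k).lTensor A) <| by
    rw [balancingSubmodule, Submodule.span_le]
    rintro _ ⟨a, b, m, rfl⟩
    refine Submodule.subset_span ⟨a, b, f m, ?_⟩
    simp

/-- `A` is faithfully flat as a right `B`-module: the functor `A ⊗_B -` on left `B`-modules
preserves and reflects exact sequences. -/
def IsRightFaithfullyFlat : Prop :=
  ∀ (L M N : Type u) [AddCommGroup L] [Module k L] [Module B L] [IsScalarTower k B L]
    [AddCommGroup M] [Module k M] [Module B M] [IsScalarTower k B M]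
    [AddCommGroup N] [Module k N] [Module B N] [IsScalarTower k B N]
    (f : L →ₗ[B] M) (g : M →ₗ[B] N),
    Function.Exact f g ↔ Function.Exact (TensorOver.map B f) (TensorOver.map B g)

end FaithfullyFlat

/-! ### Quantum homogeneous spaces -/

section QuantumHomogeneousSpaces

variable {k : Type*} {A : Type u} [Field k] [Ring A] [HopfAlgebra k A]

/-- The subspace `B⁺ = B ∩ ker ε`. -/
def augmentation (B : Subalgebra k A) : Submodule k A :=
  Subalgebra.toSubmodule B ⊓ LinearMap.ker (Coalgebra.counit (R := k) (A := A))

/-- A quantum homogeneous `A`-space: a left coideal subalgebra `B ⊆ A`, i.e. `Δ(B) ⊆ A ⊗ B`, such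
that `A` is faithfully flat as a right `B`-module and `B⁺A = AB⁺`. -/
class IsQuantumHomogeneousSpace (B : Subalgebra k A) : Prop where
  comul_mem : ∀ b ∈ B, Coalgebra.comul (R := k) b ∈
    LinearMap.range ((Subalgebra.toSubmodule B).subtype.lTensor A)
  isRightFaithfullyFlat : IsRightFaithfullyFlat B
  augmentation_mul_top : augmentation B * ⊤ = ⊤ * augmentation B

/-- The left ideal `AB⁺` of `A`; it equals `B⁺A` when `B` is a quantum homogeneous space. -/
def augIdeal (B : Subalgebra k A) : Ideal A :=
  Ideal.span (augmentation B : Set A)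

theorem restrictScalars_augIdeal (B : Subalgebra k A) :
    (augIdeal B).restrictScalars k = ⊤ * augmentation B := by
  apply le_antisymm
  · intro x hx
    change x ∈ Ideal.span _ at hx
    refine Submodule.span_induction (p := fun y _ => y ∈ (⊤ * augmentation B : Submodule k A))
      ?_ ?_ ?_ ?_ hx
    · intro y hy
      simpa using Submodule.mul_mem_mul (Submodule.mem_top (x := (1 : A))) hy
    · exact zero_mem _
    · intro y z _ _ hy hz
      exact add_mem hy hz
    · intro a y _ hy
      have := Submodule.mul_mem_mul (Submodule.mem_top (R := k) (x := a)) hy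
      rw [← mul_assoc] at this
      exact (mul_le_mul' le_top (le_refl (augmentation B)) : _ ≤ ⊤ * augmentation B) this
  · rw [Submodule.mul_le]
    intro a _ b hb
    exact (augIdeal B).mul_mem_left a (Ideal.subset_span hb)

instance (B : Subalgebra k A) [h : IsQuantumHomogeneousSpace B] : (augIdeal B).IsTwoSided where
  mul_mem_of_left {x} y hx := by
    have key : ∀ z, z ∈ augIdeal B ↔ z ∈ augmentation B * (⊤ : Submodule k A) := fun z => by
      rw [h.augmentation_mul_top, ← restrictScalars_augIdeal]; rfl
    rw [key] at hx ⊢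
    have := Submodule.mul_mem_mul hx (Submodule.mem_top (R := k) (x := y))
    rw [mul_assoc] at this
    exact (mul_le_mul' (le_refl (augmentation B)) le_top : _ ≤ augmentation B * ⊤) this

theorem counit_eq_zero_of_mem_augIdeal (B : Subalgebra k A) {x : A} (hx : x ∈ augIdeal B) :
    Coalgebra.counit (R := k) x = 0 := by
  have : augIdeal B ≤ RingHom.ker (Bialgebra.counitAlgHom k A) := by
    rw [augIdeal, Ideal.span_le]
    exact fun y hy => hy.2
  exact this hx

/-- For `b ∈ B`, the element `Δ(b) - b ⊗ 1` lies in `A ⊗ B⁺`. -/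
theorem comul_sub_mem (B : Subalgebra k A) [h : IsQuantumHomogeneousSpace B] {b : A} (hb : b ∈ B) :
    Coalgebra.comul (R := k) b - b ⊗ₜ[k] 1 ∈
      LinearMap.range ((augmentation B).subtype.lTensor A) := by
  obtain ⟨t, ht⟩ := h.comul_mem b hb
  have key : ∀ t : A ⊗[k] (Subalgebra.toSubmodule B),
      (Subalgebra.toSubmodule B).subtype.lTensor A t -
        (TensorProduct.rid k A (Coalgebra.counit.lTensor A
          ((Subalgebra.toSubmodule B).subtype.lTensor A t))) ⊗ₜ[k] (1 : A) ∈
      LinearMap.range ((augmentation B).subtype.lTensor A) := by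
    intro t
    induction t with
    | zero => simp
    | add x y hx hy =>
      simp only [map_add, TensorProduct.add_tmul]
      rw [add_sub_add_comm]
      exact add_mem hx hy
    | tmul a c =>
      refine ⟨a ⊗ₜ ⟨(c : A) - algebraMap k A (Coalgebra.counit (R := k) (c : A)),
        sub_mem c.2 (B.algebraMap_mem _), by simp⟩, ?_⟩
      simp [TensorProduct.tmul_sub, Algebra.algebraMap_eq_smul_one, TensorProduct.smul_tmul']
  have := key t
  rw [ht] at this
  simpa using this

instance (B : Subalgebra k A) [h : IsQuantumHomogeneousSpace B] :
    (augIdeal B).IsHopfIdeal k where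
  counit_eq_zero _ hx := counit_eq_zero_of_mem_augIdeal B hx
  map_mkQ_comul_eq_zero := by
    let q := Ideal.Quotient.mkₐ k (augIdeal B)
    let φ := (Algebra.TensorProduct.map q q).comp (Bialgebra.comulAlgHom k A)
    have : augIdeal B ≤ RingHom.ker φ := by
      refine Ideal.span_le.2 ?_
      intro b hb
      have hq : ∀ c ∈ augmentation B, q c = 0 := fun c hc =>
        Ideal.Quotient.eq_zero_iff_mem.2 (Ideal.subset_span hc)
      obtain ⟨t, ht⟩ := comul_sub_mem B hb.1
      have h0 : ∀ t, Algebra.TensorProduct.map q q ((augmentation B).subtype.lTensor A t) = 0 := by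
        intro t
        induction t with
        | zero => simp
        | add x y hx hy => simp [hx, hy]
        | tmul a c => simp [hq c c.2]
      have h1 := h0 t
      rw [ht, map_sub, Algebra.TensorProduct.map_tmul, hq b hb, TensorProduct.zero_tmul,
        sub_zero] at h1
      exact h1
    exact fun x hx => this hx
  antipode_mem := by
    have hS : ∀ b ∈ augmentation B, HopfAlgebra.antipode k b ∈ augIdeal B := by
      intro b hb
      obtain ⟨t, ht⟩ := comul_sub_mem B hb.1
      have h0 : ∀ t, LinearMap.mul' k A ((HopfAlgebra.antipode k).rTensor A
          ((augmentation B).subtype.lTensor A t)) ∈ augIdeal B := by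
        intro t
        induction t with
        | zero => simp
        | add x y hx hy =>
          simp only [map_add]
          exact add_mem hx hy
        | tmul a c =>
          simpa using (augIdeal B).mul_mem_left _ (Ideal.subset_span c.2)
      have h1 := h0 t
      have hb0 : Coalgebra.counit (R := k) b = 0 := hb.2
      rw [ht, map_sub, map_sub, HopfAlgebra.mul_antipode_rTensor_comul_apply, hb0] at h1
      simpa using h1
    intro x hx
    refine Submodule.span_induction (p := fun y _ => HopfAlgebra.antipode k y ∈ augIdeal B)
      ?_ ?_ ?_ ?_ hx
    · exact fun y hy => hS y hy
    · simp
    · intro y z _ _ hy hz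
      rw [map_add]
      exact add_mem hy hz
    · intro a y _ hy
      rw [smul_eq_mul, HopfAlgebra.antipode_mul_antidistrib]
      exact (augIdeal B).mul_mem_right _ hy

/-- The Hopf algebra `π_B(A) = A / B⁺A`. -/
abbrev FiberHopf (B : Subalgebra k A) : Type u := A ⧸ augIdeal B

/-- The canonical Hopf algebra surjection `π_B : A → A / B⁺A`. -/
noncomputable def proj (B : Subalgebra k A) [IsQuantumHomogeneousSpace B] : A →ₐc[k] FiberHopf B :=
  Bialgebra.Quotient.mkBialgHom (augIdeal B)

theorem augIdeal_mono {B P : Subalgebra k A} (h : B ≤ P) : augIdeal B ≤ augIdeal P :=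
  Ideal.span_mono fun _ hx => ⟨h hx.1, hx.2⟩

/-- The canonical Hopf algebra surjection `π_{B,P} : π_B(A) → π_P(A)`, `π_B(a) ↦ π_P(a)`, for
`B ⊆ P`. -/
noncomputable def projOfLE {B P : Subalgebra k A} [IsQuantumHomogeneousSpace B]
    [IsQuantumHomogeneousSpace P] (h : B ≤ P) : FiberHopf B →ₐc[k] FiberHopf P :=
  .ofAlgHom (Ideal.Quotient.factorₐ k (augIdeal_mono h)) (by
    ext x
    obtain ⟨a, rfl⟩ := Ideal.Quotient.mk_surjective x
    exact (Bialgebra.Quotient.counit_mk (R := k) (augIdeal P) a).trans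
      (Bialgebra.Quotient.counit_mk (R := k) (augIdeal B) a).symm) (by
    ext x
    obtain ⟨a, rfl⟩ := Ideal.Quotient.mk_surjective x
    have key : ∀ t : A ⊗[k] A,
        Algebra.TensorProduct.map (Ideal.Quotient.factorₐ k (augIdeal_mono h))
          (Ideal.Quotient.factorₐ k (augIdeal_mono h))
          (TensorProduct.map (Ideal.Quotient.mkₐ k (augIdeal B)).toLinearMap
            (Ideal.Quotient.mkₐ k (augIdeal B)).toLinearMap t) =
        TensorProduct.map (Ideal.Quotient.mkₐ k (augIdeal P)).toLinearMap
            (Ideal.Quotient.mkₐ k (augIdeal P)).toLinearMap t := by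
      intro t
      induction t with
      | zero => simp
      | add x y hx hy => simp only [map_add, hx, hy]
      | tmul x y => rfl
    exact (congrArg _ (Bialgebra.Quotient.comul_mk (R := k) (augIdeal B) a)).trans
      ((key _).trans (Bialgebra.Quotient.comul_mk (R := k) (augIdeal P) a).symm))

/-- A principal `A`-pair: quantum homogeneous `A`-spaces `B ⊆ P` such that
`π_B(P) = π_B(A)^{co(π_P(A))}` is a Hopf subalgebra of `π_B(A)`. -/
structure IsPrincipalPair (B P : Subalgebra k A) : Prop where
  base : IsQuantumHomogeneousSpace B
  total : IsQuantumHomogeneousSpace P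
  le : B ≤ P
  map_proj_eq : P.map (proj B : A →ₐ[k] FiberHopf B) = coinvariants (projOfLE le)
  isHopfSubalgebra : IsHopfSubalgebra (P.map (proj B : A →ₐ[k] FiberHopf B))

end QuantumHomogeneousSpaces

/-! ### The quotient by the grouplike elements -/

section GroupLikes

variable (k : Type*) (H : Type*) [Field k] [Ring H] [HopfAlgebra k H]

/-- The subalgebra `kΓ_H` of `H`: the image of the group algebra of the group `Γ_H` of grouplike
elements of `H` (the map `k[Γ_H] → H` is injective). -/
noncomputable def groupLikeAlgebra : Subalgebra k H :=
  (MonoidAlgebra.lift k H (GroupLike k H) (GroupLike.valMonoidHom k H)).range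

/-- The two-sided ideal of `H` generated by the elements `g - 1` with `g` grouplike. -/
def groupLikeIdeal : Ideal H :=
  (TwoSidedIdeal.span {x : H | ∃ g : H, IsGroupLikeElem k g ∧ x = g - 1}).asIdeal

instance : (groupLikeIdeal k H).IsTwoSided :=
  inferInstanceAs (TwoSidedIdeal.asIdeal _).IsTwoSided

variable {H} in
theorem groupLikeIdeal_le {J : Ideal H} [J.IsTwoSided]
    (h : ∀ g : H, IsGroupLikeElem k g → g - 1 ∈ J) : groupLikeIdeal k H ≤ J := by
  have : TwoSidedIdeal.span {x : H | ∃ g : H, IsGroupLikeElem k g ∧ x = g - 1} ≤ J.toTwoSided := by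
    rw [TwoSidedIdeal.span_le]
    rintro _ ⟨g, hg, rfl⟩
    exact Ideal.mem_toTwoSided.2 (h g hg)
  exact fun x hx => Ideal.mem_toTwoSided.1 (this (TwoSidedIdeal.mem_asIdeal.1 hx))

variable {k H} in
theorem sub_one_mem_groupLikeIdeal {g : H} (hg : IsGroupLikeElem k g) :
    g - 1 ∈ groupLikeIdeal k H :=
  TwoSidedIdeal.mem_asIdeal.2 (TwoSidedIdeal.subset_span ⟨g, hg, rfl⟩)

instance : (groupLikeIdeal k H).IsHopfIdeal k where
  counit_eq_zero := by
    have : groupLikeIdeal k H ≤ RingHom.ker (Bialgebra.counitAlgHom k H) :=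
      groupLikeIdeal_le k fun g hg => by simp [RingHom.mem_ker, hg.counit_eq_one]
    exact fun x hx => this hx
  map_mkQ_comul_eq_zero := by
    let q := Ideal.Quotient.mkₐ k (groupLikeIdeal k H)
    let φ := (Algebra.TensorProduct.map q q).comp (Bialgebra.comulAlgHom k H)
    have : groupLikeIdeal k H ≤ RingHom.ker φ :=
      groupLikeIdeal_le k fun g hg => by
        have hq : q g = 1 := by
          have := Ideal.Quotient.eq_zero_iff_mem.2 (sub_one_mem_groupLikeIdeal hg)
          rw [map_sub, sub_eq_zero, map_one] at this
          exact this
        simp [RingHom.mem_ker, φ, hg.comul_eq_tmul_self, hq, Algebra.TensorProduct.one_def]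
    exact fun x hx => this hx
  antipode_mem := by
    let J : Ideal H :=
      { carrier := {x | HopfAlgebra.antipode k x ∈ groupLikeIdeal k H}
        add_mem' := fun {x y} hx hy => by
          change HopfAlgebra.antipode k (x + y) ∈ groupLikeIdeal k H
          rw [map_add]
          exact add_mem hx hy
        zero_mem' := by simp
        smul_mem' := fun a x hx => by
          change HopfAlgebra.antipode k (a * x) ∈ groupLikeIdeal k H
          rw [HopfAlgebra.antipode_mul_antidistrib]
          exact Ideal.mul_mem_right _ _ hx }
    have : J.IsTwoSided := ⟨fun {x} y hx => by
      change HopfAlgebra.antipode k (x * y) ∈ groupLikeIdeal k H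
      rw [HopfAlgebra.antipode_mul_antidistrib]
      exact Ideal.mul_mem_left _ _ hx⟩
    have hJ : groupLikeIdeal k H ≤ J := groupLikeIdeal_le k fun g hg => by
      change HopfAlgebra.antipode k (g - 1) ∈ groupLikeIdeal k H
      rw [map_sub, HopfAlgebra.antipode_one]
      exact sub_one_mem_groupLikeIdeal hg.antipode
    exact fun x hx => hJ hx

/-- The Hopf algebra `K_H = H / ⟨g - 1 | g ∈ Γ_H⟩`. -/
abbrev KQuot : Type _ := H ⧸ groupLikeIdeal k H

/-- The canonical Hopf algebra projection `H → K_H`. -/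
noncomputable def projK : H →ₐc[k] KQuot k H :=
  Bialgebra.Quotient.mkBialgHom (groupLikeIdeal k H)

end GroupLikes

end QHS

/-! Everything rests on normalised integrals, that is, functionals `h` with `h 1 = 1` and y₁ h(y₂) =
h(y) 1. Suppose that π : A → H is a surjection of Hopf algebras with bijective antipodes and that H
has such an `h`. Then B = A^{co(H)} is a quantum homogeneous space with B⁺A = AB⁺ = ker π
(`isQuantumHomogeneousSpace_coinvariants`, `mem_augIdeal_coinvariants`). Averaging a linear section
of π with `h` gives a counit-preserving left H-colinear map s : H → A (`exists_leftColinear`). The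
formula a ↦ a₁ S(s(π(a₂))₁) ⊗ s(π(a₂))₂ is then a left B-linear splitting of the multiplication B ⊗
A → A (`exists_left_splitting`). The same argument in the opposite Hopf algebras gives a right
B-linear splitting, so A is a direct summand of a free right B-module. The Reynolds operator a ↦ a₁
h(π(a₂)) is a right B-linear projection of A onto B. Together these give faithful flatness
(`isRightFaithfullyFlat_of_splitting`).

It remains to find integrals on H and on K_H. On H, take the counit on ℂ1 and zero on every other
simple subcoalgebra. For K_H, let η be the counit on all lines ℂg with g grouplike and zero on the
other simple subcoalgebras. Multiplication by a grouplike element permutes the simple subcoalgebras,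
so η(gx) = η(x); as grouplikes are central, η kills the ideal defining K_H and descends to a
normalised integral there (`IsGroupLikeProjection.exists_integral`).

Applying this integral to the coinvariance equation gives x = x₁ η(x₂), an element of ℂΓ_H, whence
H^{co(K_H)} = ℂΓ_H (`coinvariants_projK`). The Reynolds operators of A and H for K_H are intertwined
by π, so π(P) = H^{co(K_H)} (`map_coinvariants_comp`). Finally AB⁺ = ker π identifies π_B(A) with H,
and the conditions on a principal pair become these equalities. -/

namespace QHS

/-! ### Antipodes through the convolution product -/

section Convolution

open Coalgebra HopfAlgebra WithConv

variable {k : Type*} [Field k]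

section Antipode

variable {A H : Type*} [Ring A] [HopfAlgebra k A] [Ring H] [HopfAlgebra k H]

/-- Both sides are convolution inverses of `π` in Hom(A, H), and an inverse is unique. -/
theorem map_antipode (π : A →ₐc[k] H) (a : A) :
    π (antipode k a) = antipode k (π a) := by
  let p : A →ₗ[k] H := (π : A →ₐ[k] H).toLinearMap
  have h1 : toConv (antipode k ∘ₗ p) * toConv p = 1 := by
    have := LinearMap.convMul_comp_coalgHom_distrib (toConv (antipode k (A := H)))
      (toConv (LinearMap.id : H →ₗ[k] H)) (π : A →ₗc[k] H)
    rw [LinearMap.antipode_mul_id] at this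
    refine WithConv.ext (this.symm.trans ?_)
    ext x
    simp
  have h2 : toConv p * toConv (p ∘ₗ antipode k) = 1 := by
    have := LinearMap.algHom_comp_convMul_distrib (π : A →ₐ[k] H)
      (toConv (LinearMap.id : A →ₗ[k] A)) (toConv (antipode k (A := A)))
    rw [LinearMap.id_mul_antipode] at this
    refine WithConv.ext (this.symm.trans ?_)
    ext x
    simpa using AlgHomClass.commutes π _
  have h3 := left_inv_eq_right_inv h1 h2
  exact (LinearMap.congr_fun (toConv_injective h3) a).symm

/-- The antipode reverses the comultiplication. -/
theorem comul_antipode (a : A) :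
    comul (R := k) (antipode k a) =
      TensorProduct.map (antipode k) (antipode k) (TensorProduct.comm k A A (comul a)) := by
  let i₁ : A →ₐ[k] A ⊗[k] A := Algebra.TensorProduct.includeLeft
  let i₂ : A →ₐ[k] A ⊗[k] A := Algebra.TensorProduct.includeRight
  let S : A →ₗ[k] A := antipode k
  -- In Hom(A, A ⊗ A) the comultiplication is `i₁ * i₂`, so `(i₂ ∘ S) * (i₁ ∘ S)` is a left inverse
  -- of it, while Δ ∘ S is a right inverse.
  have hδ : toConv (comul (R := k) (A := A)) = toConv i₁.toLinearMap * toConv i₂.toLinearMap := by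
    refine WithConv.ext ?_
    rw [LinearMap.convMul_def]
    have : LinearMap.mul' k (A ⊗[k] A) ∘ₗ TensorProduct.map i₁.toLinearMap i₂.toLinearMap =
        LinearMap.id := by
      ext x y; simp [i₁, i₂]
    simp [← LinearMap.comp_assoc, this]
  have hG : toConv (TensorProduct.map S S ∘ₗ (TensorProduct.comm k A A).toLinearMap ∘ₗ comul) =
      toConv (i₂.toLinearMap ∘ₗ S) * toConv (i₁.toLinearMap ∘ₗ S) := by
    refine WithConv.ext ?_
    rw [LinearMap.convMul_def]
    have : LinearMap.mul' k (A ⊗[k] A) ∘ₗ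
        TensorProduct.map (i₂.toLinearMap ∘ₗ S) (i₁.toLinearMap ∘ₗ S) =
        TensorProduct.map S S ∘ₗ (TensorProduct.comm k A A).toLinearMap := by
      ext x y; simp [i₁, i₂]
    simp only [← LinearMap.comp_assoc, this]
  have hi : ∀ i : A →ₐ[k] A ⊗[k] A,
      toConv (i.toLinearMap ∘ₗ S) * toConv i.toLinearMap = 1 := by
    intro i
    have := LinearMap.algHom_comp_convMul_distrib i
      (toConv (antipode k (A := A))) (toConv (LinearMap.id : A →ₗ[k] A))
    rw [LinearMap.antipode_mul_id] at this
    refine WithConv.ext (this.symm.trans ?_)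
    ext x
    simp
  have hl : toConv (TensorProduct.map S S ∘ₗ (TensorProduct.comm k A A).toLinearMap ∘ₗ comul) *
      toConv (comul (R := k) (A := A)) = 1 := by
    rw [hG, hδ, mul_assoc, ← mul_assoc (toConv (i₁.toLinearMap ∘ₗ S)), hi, one_mul, hi]
  have h3 := left_inv_eq_right_inv hl LinearMap.comul_right_inv
  exact (LinearMap.congr_fun (toConv_injective h3) a).symm

end Antipode

end Convolution

/-! ### Integrals and colinear sections -/

section Sections

open Coalgebra HopfAlgebra WithConv

variable {k : Type*} [Field k]

/-- A normalised (right) integral `h`: `h(1) = 1` and `y₍₁₎ h(y₍₂₎) = h(y) 1`. -/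
structure IsNormalisedIntegral {H : Type*} [Ring H] [Bialgebra k H] (h : H →ₗ[k] k) : Prop where
  map_one : h 1 = 1
  rid_lTensor_comul : ∀ y : H, TensorProduct.rid k H (h.lTensor H (comul y)) = h y • (1 : H)

variable {A H : Type*} [Ring A] [HopfAlgebra k A] [Ring H] [HopfAlgebra k H]

/-- The right coaction `a ↦ a₍₁₎ ⊗ π(a₍₂₎)`. -/
noncomputable def rightCoaction (π : A →ₐc[k] H) : A →ₐ[k] A ⊗[k] H :=
  (Algebra.TensorProduct.map (AlgHom.id k A) (π : A →ₐ[k] H)).comp (Bialgebra.comulAlgHom k A)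

/-- The left coaction `a ↦ π(a₍₁₎) ⊗ a₍₂₎`. -/
noncomputable def leftCoaction (π : A →ₐc[k] H) : A →ₗ[k] H ⊗[k] A :=
  ((π : A →ₐ[k] H).toLinearMap.rTensor A) ∘ₗ comul

theorem mem_coinvariants {π : A →ₐc[k] H} {a : A} :
    a ∈ coinvariants π ↔ rightCoaction π a = a ⊗ₜ 1 :=
  Iff.rfl

theorem rightCoaction_apply (π : A →ₐc[k] H) (a : A) :
    rightCoaction π a = (π : A →ₐ[k] H).toLinearMap.lTensor A (comul a) :=
  rfl

/-- `y₍₁₎ h(y₍₂₎ S(z)) = h(y S(z₍₁₎)) z₍₂₎`. -/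
theorem IsNormalisedIntegral.mul_antipode {h : H →ₗ[k] k} (hh : IsNormalisedIntegral h) (y z : H) :
    TensorProduct.rid k H (h.lTensor H (comul y * (1 : H) ⊗ₜ[k] antipode k z)) =
      TensorProduct.lid k H
        ((h ∘ₗ LinearMap.mulLeft k y ∘ₗ antipode k).rTensor H (comul z)) := by
  let r : H ⊗[k] H →ₗ[k] H := (TensorProduct.rid k H).toLinearMap ∘ₗ h.lTensor H
  let L (t : H ⊗[k] H) : H →ₗ[k] H :=
    r ∘ₗ LinearMap.mulLeft k t ∘ₗ (TensorProduct.mk k H H 1) ∘ₗ antipode k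
  let N (t : H ⊗[k] H) : H →ₗ[k] H := r ∘ₗ LinearMap.mulLeft k t ∘ₗ comul ∘ₗ antipode k
  -- For t = Δ(y), L(z) = y₁ h(y₂ S(z)), and Δ(S(z)) = S(z₂) ⊗ S(z₁) gives N = L * S. Hence L = N *
  -- id, and the integral property turns N(z) into h(y S(z)) 1.
  have hN : ∀ t, toConv (N t) = toConv (L t) * toConv (antipode k) := by
    intro t
    refine WithConv.ext ?_
    ext x
    have key : ∀ w : H ⊗[k] H,
        r (t * TensorProduct.map (antipode k) (antipode k) (TensorProduct.comm k H H w)) =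
          LinearMap.mul' k H (TensorProduct.map (L t) (antipode k) w) := by
      intro w
      induction w with
      | zero => simp
      | add p q hp hq => simp only [map_add, mul_add, hp, hq]
      | tmul p q =>
        induction t with
        | zero => simp [L]
        | add t₁ t₂ h₁ h₂ =>
          have : L (t₁ + t₂) = L t₁ + L t₂ := by
            ext; simp [L, add_mul]
          rw [add_mul, map_add, h₁, h₂, this, TensorProduct.map_add_left, LinearMap.add_apply,
            map_add]
        | tmul a b => simp [L, r]
    have := key (comul x)
    rw [← comul_antipode] at this
    exact this
  have hN' : toConv (N (comul y)) * toConv LinearMap.id = toConv (L (comul y)) := by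
    rw [hN, mul_assoc, LinearMap.antipode_mul_id, mul_one]
  have h1 := LinearMap.congr_fun (congrArg WithConv.ofConv hN') z
  refine Eq.trans h1.symm ?_
  rw [LinearMap.convMul_apply]
  have key : ∀ w : H ⊗[k] H,
      LinearMap.mul' k H (TensorProduct.map (N (comul y)) LinearMap.id w) =
        TensorProduct.lid k H
          ((h ∘ₗ LinearMap.mulLeft k y ∘ₗ antipode k).rTensor H w) := by
    intro w
    induction w with
    | zero => simp
    | add p q hp hq => simp only [map_add, hp, hq]
    | tmul p q =>
      have : N (comul y) p = h (y * antipode k p) • (1 : H) := by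
        rw [← hh.rid_lTensor_comul, Bialgebra.comul_mul]
        rfl
      simp [this]
  exact key _

theorem lTensor_leftCoaction (π : A →ₐc[k] H) (a : A) :
    (leftCoaction π).lTensor H (leftCoaction π a) =
      TensorProduct.assoc k H H A ((comul (R := k) (A := H)).rTensor A (leftCoaction π a)) := by
  let p : A →ₗ[k] H := (π : A →ₐ[k] H).toLinearMap
  have h1 : ∀ t : A ⊗[k] A, (leftCoaction π).lTensor H (p.rTensor A t) =
      TensorProduct.map p (p.rTensor A) ((comul (R := k) (A := A)).lTensor A t) := by
    intro t
    induction t with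
    | zero => simp
    | add x y hx hy => simp only [map_add, hx, hy]
    | tmul x y => rfl
  have h2 : ∀ t : A ⊗[k] A,
      TensorProduct.assoc k H H A ((comul (R := k) (A := H)).rTensor A (p.rTensor A t)) =
      TensorProduct.map p (p.rTensor A)
        (TensorProduct.assoc k A A A ((comul (R := k) (A := A)).rTensor A t)) := by
    intro t
    induction t with
    | zero => simp
    | add x y hx hy => simp only [map_add, hx, hy]
    | tmul x y =>
      have h3 : comul (R := k) (p x) = TensorProduct.map p p (comul x) :=
        (CoalgHomClass.map_comp_comul_apply π x).symm
      simp only [LinearMap.rTensor_tmul, h3]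
      induction (comul (R := k) x) with
      | zero => simp
      | add x y hx hy => simp only [map_add, TensorProduct.add_tmul, hx, hy]
      | tmul x y => simp
  change (leftCoaction π).lTensor H (p.rTensor A _) =
    TensorProduct.assoc k H H A ((comul (R := k) (A := H)).rTensor A (p.rTensor A _))
  rw [h1, h2, coassoc_apply]

/-- If `H` has a normalised integral, a surjection `π : A → H` yields a left `H`-colinear map
`H → A` which preserves the counit. -/
theorem exists_leftColinear {π : A →ₐc[k] H} (hπ : Function.Surjective π) {h : H →ₗ[k] k}
    (hh : IsNormalisedIntegral h) :
    ∃ s : H →ₗ[k] A, (∀ x, leftCoaction π (s x) = s.lTensor H (comul x)) ∧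
      ∀ x, counit (R := k) (s x) = counit (R := k) x := by
  obtain ⟨σ, hσ⟩ := (π : A →ₐ[k] H).toLinearMap.exists_rightInverse_of_surjective
    (LinearMap.range_eq_top.2 hπ)
  let f (y : H) : H →ₗ[k] k := h ∘ₗ LinearMap.mulLeft k y ∘ₗ antipode k
  have f_add : ∀ y y', f (y + y') = f y + f y' := fun y y' => by
    ext; simp [f, add_mul]
  have f_smul : ∀ (c : k) y, f (c • y) = c • f y := fun c y => by
    ext; simp [f]
  -- J(y ⊗ c) = h(y S(π(c₁))) c₂. By `IsNormalisedIntegral.mul_antipode` it is left H-colinear when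
  -- H ⊗ A carries the coaction of its first factor only.
  let J : H ⊗[k] A →ₗ[k] A := TensorProduct.lift <| LinearMap.mk₂ k
    (fun y c => TensorProduct.lid k A ((f y).rTensor A (leftCoaction π c)))
    (fun y y' c => by rw [f_add, LinearMap.rTensor_add, LinearMap.add_apply, map_add])
    (fun r y c => by rw [f_smul, LinearMap.rTensor_smul, LinearMap.smul_apply, map_smul])
    (fun y c c' => by simp only [map_add])
    (fun r y c => by simp only [map_smul])
  have hJ : ∀ y c, J (y ⊗ₜ c) = TensorProduct.lid k A ((f y).rTensor A (leftCoaction π c)) :=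
    fun y c => rfl
  have hJcol : ∀ t : H ⊗[k] A, leftCoaction π (J t) =
      J.lTensor H (TensorProduct.assoc k H H A ((comul (R := k) (A := H)).rTensor A t)) := by
    intro t
    induction t with
    | zero => simp
    | add x y hx hy => simp only [map_add, hx, hy]
    | tmul y c =>
      have e1 : ∀ w : H ⊗[k] A, leftCoaction π (TensorProduct.lid k A ((f y).rTensor A w)) =
          TensorProduct.lid k (H ⊗[k] A) ((f y).rTensor (H ⊗[k] A)
            ((leftCoaction π).lTensor H w)) := by
        intro w
        induction w with
        | zero => simp
        | add x y hx hy => simp only [map_add, hx, hy]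
        | tmul z c => simp
      have e2 : ∀ t : H ⊗[k] H, J.lTensor H (TensorProduct.assoc k H H A (t ⊗ₜ c)) =
          (((TensorProduct.rid k H).toLinearMap ∘ₗ h.lTensor H ∘ₗ LinearMap.mulLeft k t ∘ₗ
            (TensorProduct.mk k H H 1) ∘ₗ antipode k).rTensor A) (leftCoaction π c) := by
        intro t
        induction t with
        | zero => simp
        | add t₁ t₂ h₁ h₂ =>
          rw [TensorProduct.add_tmul, map_add, map_add, h₁, h₂, ← LinearMap.add_apply,
            ← LinearMap.rTensor_add]
          congr 2
          ext
          simp [add_mul]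
        | tmul a b =>
          simp only [TensorProduct.assoc_tmul, LinearMap.lTensor_tmul, hJ]
          induction leftCoaction π c with
          | zero => simp
          | add x y hx hy => simp only [map_add, TensorProduct.tmul_add, hx, hy]
          | tmul z c => simp [f, TensorProduct.smul_tmul']
      rw [hJ, e1, lTensor_leftCoaction, LinearMap.rTensor_tmul, e2]
      induction leftCoaction π c with
      | zero => simp
      | add x y hx hy => simp only [map_add, hx, hy]
      | tmul z c =>
        have := hh.mul_antipode y z
        simp only [LinearMap.rTensor_tmul, LinearMap.comp_apply, LinearMap.mulLeft_apply,
          TensorProduct.mk_apply, LinearEquiv.coe_coe, this]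
        induction comul (R := k) z with
        | zero => simp
        | add x y hx hy => simp only [map_add, TensorProduct.add_tmul, hx, hy]
        | tmul z c => simp [f, TensorProduct.smul_tmul']
  have hJε : ∀ y c, counit (R := k) (J (y ⊗ₜ c)) = h (y * antipode k (π c)) := by
    intro y c
    have : ∀ t : A ⊗[k] A, counit (R := k) (TensorProduct.lid k A ((f y).rTensor A
        ((π : A →ₐ[k] H).toLinearMap.rTensor A t))) =
        f y (π (TensorProduct.rid k A ((counit (R := k) (A := A)).lTensor A t))) := by
      intro t
      induction t with
      | zero => simp
      | add x y hx hy => simp only [map_add, hx, hy]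
      | tmul a b => simp [mul_comm]
    rw [hJ]
    refine (this (comul c)).trans ?_
    simp [f]
  -- The colinear map is x ↦ J(x₁ ⊗ σ(x₂)), where σ is any linear section of `π`. Its counit is h(x₁
  -- S(x₂)) = ε(x) h(1).
  refine ⟨J ∘ₗ σ.lTensor H ∘ₗ comul, fun x => ?_, fun x => ?_⟩
  · have : ∀ t : H ⊗[k] H, TensorProduct.assoc k H H A
        ((comul (R := k) (A := H)).rTensor A (σ.lTensor H t)) =
        (σ.lTensor H).lTensor H
          (TensorProduct.assoc k H H H ((comul (R := k) (A := H)).rTensor H t)) := by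
      intro t
      induction t with
      | zero => simp
      | add x y hx hy => simp only [map_add, hx, hy]
      | tmul y x =>
        simp only [LinearMap.lTensor_tmul, LinearMap.rTensor_tmul]
        induction comul (R := k) y with
        | zero => simp
        | add x y hx hy => simp only [map_add, TensorProduct.add_tmul, hx, hy]
        | tmul z c => simp
    simp only [LinearMap.comp_apply, hJcol, this, coassoc_apply, LinearMap.lTensor_comp]
  · have : ∀ t : H ⊗[k] H, counit (R := k) (J (σ.lTensor H t)) =
        h (LinearMap.mul' k H ((antipode k).lTensor H t)) := by
      intro t
      induction t with
      | zero => simp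
      | add x y hx hy => simp only [map_add, hx, hy]
      | tmul y x =>
        have hx : π (σ x) = x := LinearMap.congr_fun hσ x
        simp [hJε, hx]
    simp [this, Algebra.algebraMap_eq_smul_one, hh.map_one]

end Sections

/-! ### The splitting of the multiplication built from a colinear section -/

section Splitting

open Coalgebra HopfAlgebra WithConv

variable {k : Type*} [Field k] {A H : Type*} [Ring A] [HopfAlgebra k A] [Ring H] [HopfAlgebra k H]

theorem rightCoaction_antipode (π : A →ₐc[k] H) (a : A) :
    rightCoaction π (antipode k a) =
      TensorProduct.map (antipode k) (antipode k)
        (TensorProduct.comm k H A (leftCoaction π a)) := by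
  rw [rightCoaction_apply, comul_antipode, leftCoaction, LinearMap.comp_apply]
  induction comul (R := k) a with
  | zero => simp
  | add x y hx hy => simp only [map_add, hx, hy]
  | tmul x y => simp [map_antipode]

theorem rTensor_leftCoaction_comul (π : A →ₐc[k] H) (a : A) :
    (leftCoaction π).rTensor A (comul a) =
      (TensorProduct.assoc k H A A).symm
        ((comul (R := k) (A := A)).lTensor H (leftCoaction π a)) := by
  let p : A →ₗ[k] H := (π : A →ₐ[k] H).toLinearMap
  have h1 : ∀ t : A ⊗[k] A, (leftCoaction π).rTensor A t =
      (p.rTensor A).rTensor A ((comul (R := k) (A := A)).rTensor A t) := by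
    intro t
    rw [leftCoaction, LinearMap.rTensor_comp]
    rfl
  have h2 : ∀ t : A ⊗[k] A, (comul (R := k) (A := A)).lTensor H (p.rTensor A t) =
      p.rTensor (A ⊗[k] A) ((comul (R := k) (A := A)).lTensor A t) := by
    intro t
    induction t with
    | zero => simp
    | add x y hx hy => simp only [map_add, hx, hy]
    | tmul x y => simp
  have h3 : ∀ t : A ⊗[k] (A ⊗[k] A), (TensorProduct.assoc k H A A).symm
      (p.rTensor (A ⊗[k] A) t) =
      (p.rTensor A).rTensor A ((TensorProduct.assoc k A A A).symm t) := by
    intro t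
    induction t with
    | zero => simp
    | add x y hx hy => simp only [map_add, hx, hy]
    | tmul x y =>
      induction y with
      | zero => simp
      | add y z hy hz => simp only [map_add, TensorProduct.tmul_add, hy, hz]
      | tmul y z => simp
  change _ = (TensorProduct.assoc k H A A).symm
    ((comul (R := k) (A := A)).lTensor H (p.rTensor A (comul a)))
  rw [h1, h2, h3, coassoc_symm_apply]

variable (π : A →ₐc[k] H) (s : H →ₗ[k] A)

/-- The map `a ↦ S(a₍₁₎) ⊗ a₍₂₎`. -/
noncomputable def antipodeComul : A →ₗ[k] A ⊗[k] A :=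
  (antipode k).rTensor A ∘ₗ comul

/-- The map `a ⊗ x ↦ a S(s(x)₍₁₎) ⊗ s(x)₍₂₎`. -/
noncomputable def preSplitting : A ⊗[k] H →ₗ[k] A ⊗[k] A :=
  TensorProduct.lift <| (LinearMap.mul k (A ⊗[k] A)).compl₁₂
    (Algebra.TensorProduct.includeLeft : A →ₐ[k] A ⊗[k] A).toLinearMap (antipodeComul ∘ₗ s)

/-- The map `a ↦ a₍₁₎ S(s(π(a₍₂₎))₍₁₎) ⊗ s(π(a₍₂₎))₍₂₎`. -/
noncomputable def splitting : A →ₗ[k] A ⊗[k] A :=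
  preSplitting s ∘ₗ (rightCoaction π).toLinearMap

@[simp]
theorem preSplitting_tmul (a : A) (x : H) :
    preSplitting s (a ⊗ₜ x) = a ⊗ₜ 1 * antipodeComul (k := k) (s x) := by
  simp [preSplitting]

theorem splitting_mul {b : A} (hb : b ∈ coinvariants π) (a : A) :
    splitting π s (b * a) = b ⊗ₜ 1 * splitting π s a := by
  have : ∀ t : A ⊗[k] H, preSplitting s (b ⊗ₜ 1 * t) = b ⊗ₜ 1 * preSplitting s t := by
    intro t
    induction t with
    | zero => simp
    | add x y hx hy => simp only [map_add, mul_add, hx, hy]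
    | tmul x y =>
      rw [Algebra.TensorProduct.tmul_mul_tmul, one_mul, preSplitting_tmul, preSplitting_tmul,
        ← mul_assoc, Algebra.TensorProduct.tmul_mul_tmul, one_mul]
  simp only [splitting, LinearMap.comp_apply, AlgHom.toLinearMap_apply, map_mul,
    mem_coinvariants.1 hb, this]

variable {s}

/-- S(c₁)c₂ = ε(c) collapses the product to a₁ ε(s(π(a₂))), and `s` preserves the counit. -/
theorem mul'_splitting (hs : ∀ x, counit (R := k) (s x) = counit (R := k) x) (a : A) :
    LinearMap.mul' k A (splitting π s a) = a := by
  have h1 : ∀ (b c : A), LinearMap.mul' k A (b ⊗ₜ 1 * antipodeComul (k := k) c) =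
      counit (R := k) c • b := by
    intro b c
    have : ∀ t : A ⊗[k] A, LinearMap.mul' k A (b ⊗ₜ 1 * t) = b * LinearMap.mul' k A t := by
      intro t
      induction t with
      | zero => simp
      | add x y hx hy => simp only [map_add, mul_add, hx, hy]
      | tmul x y => simp [mul_assoc]
    rw [this, antipodeComul, LinearMap.comp_apply, mul_antipode_rTensor_comul_apply,
      Algebra.algebraMap_eq_smul_one, mul_smul_comm, mul_one]
  have h2 : ∀ t : A ⊗[k] A, LinearMap.mul' k A (preSplitting s
      ((π : A →ₐ[k] H).toLinearMap.lTensor A t)) =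
      TensorProduct.rid k A ((counit (R := k) (A := A)).lTensor A t) := by
    intro t
    induction t with
    | zero => simp
    | add x y hx hy => simp only [map_add, hx, hy]
    | tmul x y => simp [h1, hs]
  refine (h2 _).trans ?_
  simp

/-- This is what places ker π inside B⁺A: for π(a) = 0 the counit on the first leg kills the
splitting of a. -/
theorem counit_rTensor_splitting (a : A) :
    TensorProduct.lid k A ((counit (R := k) (A := A)).rTensor A (splitting π s a)) =
      s (π a) := by
  have h1 : ∀ (b c : A), TensorProduct.lid k A ((counit (R := k) (A := A)).rTensor A
      (b ⊗ₜ 1 * antipodeComul (k := k) c)) = counit (R := k) b • c := by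
    intro b c
    have : ∀ t : A ⊗[k] A, TensorProduct.lid k A ((counit (R := k) (A := A)).rTensor A
        (b ⊗ₜ 1 * (antipode k).rTensor A t)) = counit (R := k) b • TensorProduct.lid k A
          ((counit (R := k) (A := A)).rTensor A t) := by
      intro t
      induction t with
      | zero => simp
      | add x y hx hy => simp only [map_add, mul_add, smul_add, hx, hy]
      | tmul x y => simp [mul_smul]
    rw [antipodeComul, LinearMap.comp_apply, this]
    simp
  have h2 : ∀ t : A ⊗[k] A, TensorProduct.lid k A ((counit (R := k) (A := A)).rTensor A
      (preSplitting s ((π : A →ₐ[k] H).toLinearMap.lTensor A t))) =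
      s (π (TensorProduct.lid k A ((counit (R := k) (A := A)).rTensor A t))) := by
    intro t
    induction t with
    | zero => simp
    | add x y hx hy => simp only [map_add, hx, hy]
    | tmul x y => simp [h1]
  refine (h2 _).trans ?_
  simp

/-- The first leg a₁ S(s(π(a₂))₁) is coinvariant: the coaction contributes π(a₂) from the factor a₁
and, by colinearity of `s`, S(π(a₃)) from the other factor. These cancel. -/
theorem coaction_splitting (hs : ∀ x, leftCoaction π (s x) = s.lTensor H (comul x)) (a : A) :
    Algebra.TensorProduct.map (rightCoaction π) (AlgHom.id k A) (splitting π s a) =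
      Algebra.TensorProduct.map (Algebra.TensorProduct.includeLeft : A →ₐ[k] A ⊗[k] H)
        (AlgHom.id k A) (splitting π s a) := by
  let p : A →ₐ[k] H := π
  let S : A →ₗ[k] A := antipode k
  let S' : H →ₗ[k] H := antipode k
  let θ : A ⊗[k] A →ₐ[k] (A ⊗[k] H) ⊗[k] A :=
    Algebra.TensorProduct.map (rightCoaction π) (AlgHom.id k A)
  let θ' : A ⊗[k] A →ₐ[k] (A ⊗[k] H) ⊗[k] A :=
    Algebra.TensorProduct.map Algebra.TensorProduct.includeLeft (AlgHom.id k A)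
  let i₁ : A →ₐ[k] A ⊗[k] A := Algebra.TensorProduct.includeLeft
  let j : H →ₐ[k] (A ⊗[k] H) ⊗[k] A :=
    (Algebra.TensorProduct.includeLeft : A ⊗[k] H →ₐ[k] (A ⊗[k] H) ⊗[k] A).comp
      Algebra.TensorProduct.includeRight
  let V : A →ₗ[k] A ⊗[k] A := antipodeComul
  have hV : ∀ c, θ (V c) = (TensorProduct.map S S' ∘ₗ
      (TensorProduct.comm k H A).toLinearMap).rTensor A ((TensorProduct.assoc k H A A).symm
        ((comul (R := k) (A := A)).lTensor H (leftCoaction π c))) := by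
    intro c
    rw [← rTensor_leftCoaction_comul]
    have : ∀ t : A ⊗[k] A, θ (S.rTensor A t) = (TensorProduct.map S S' ∘ₗ
        (TensorProduct.comm k H A).toLinearMap).rTensor A ((leftCoaction π).rTensor A t) := by
      intro t
      induction t with
      | zero => simp
      | add x y hx hy => simp only [map_add, hx, hy]
      | tmul x y => simp [θ, S, S', rightCoaction_antipode]
    exact this _
  -- In the convolution algebra `θ` coacts on the first leg, `θ'` inserts 1 there and `j` embeds H.
  -- The splitting is `i₁ * (V ∘ s ∘ p)`, and applying `θ` produces the extra middle factor `(j ∘ p)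
  -- * (j ∘ S' ∘ p) = 1`.
  have hVs : toConv (θ.toLinearMap ∘ₗ V ∘ₗ s) =
      toConv (j.toLinearMap ∘ₗ S') * toConv (θ'.toLinearMap ∘ₗ V ∘ₗ s) := by
    refine WithConv.ext ?_
    ext x
    rw [LinearMap.convMul_apply]
    change θ (V (s x)) = _
    rw [hV, hs]
    induction comul (R := k) x with
    | zero => simp
    | add x y hx hy => simp only [map_add, hx, hy]
    | tmul y x =>
      have : ∀ w : A ⊗[k] A, (TensorProduct.map S S' ∘ₗ
          (TensorProduct.comm k H A).toLinearMap).rTensor A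
            ((TensorProduct.assoc k H A A).symm (y ⊗ₜ w)) = j (S' y) * θ' (S.rTensor A w) := by
        intro w
        induction w with
        | zero => simp
        | add x y hx hy => simp only [map_add, TensorProduct.tmul_add, mul_add, hx, hy]
        | tmul u v => simp [j, θ']
      exact this _
  have hsp : toConv (splitting π s) = toConv i₁.toLinearMap * toConv (V ∘ₗ s ∘ₗ p.toLinearMap) := by
    refine WithConv.ext ?_
    ext x
    rw [LinearMap.convMul_apply]
    change preSplitting s (p.toLinearMap.lTensor A (comul x)) = _
    induction comul (R := k) x with
    | zero => simp
    | add x y hx hy => simp only [map_add, hx, hy]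
    | tmul x y => simp [i₁, V, p]
  have hi : toConv (θ.toLinearMap ∘ₗ i₁.toLinearMap) =
      toConv (θ'.toLinearMap ∘ₗ i₁.toLinearMap) * toConv (j.toLinearMap ∘ₗ p.toLinearMap) := by
    refine WithConv.ext ?_
    ext x
    rw [LinearMap.convMul_apply]
    simp only [LinearMap.comp_apply, AlgHom.toLinearMap_apply, i₁, θ, θ',
      Algebra.TensorProduct.includeLeft_apply, Algebra.TensorProduct.map_tmul, map_one,
      rightCoaction_apply]
    induction comul (R := k) x with
    | zero => simp
    | add x y hx hy => simp only [map_add, TensorProduct.add_tmul, hx, hy]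
    | tmul x y => simp [j, p]
  have hVp : toConv (θ.toLinearMap ∘ₗ V ∘ₗ s ∘ₗ p.toLinearMap) =
      toConv (j.toLinearMap ∘ₗ S' ∘ₗ p.toLinearMap) *
        toConv (θ'.toLinearMap ∘ₗ V ∘ₗ s ∘ₗ p.toLinearMap) := by
    have h1 := LinearMap.convMul_comp_coalgHom_distrib (toConv (j.toLinearMap ∘ₗ S'))
      (toConv (θ'.toLinearMap ∘ₗ V ∘ₗ s)) (π : A →ₗc[k] H)
    rw [← hVs] at h1
    exact WithConv.ext h1
  have hj : toConv (j.toLinearMap ∘ₗ p.toLinearMap) *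
      toConv (j.toLinearMap ∘ₗ S' ∘ₗ p.toLinearMap) = 1 := by
    have h1 := LinearMap.convMul_comp_coalgHom_distrib (toConv (LinearMap.id : H →ₗ[k] H))
      (toConv S') (π : A →ₗc[k] H)
    rw [LinearMap.id_mul_antipode] at h1
    have h2 := LinearMap.algHom_comp_convMul_distrib j (toConv p.toLinearMap)
      (toConv (S' ∘ₗ p.toLinearMap))
    refine WithConv.ext (h2.symm.trans ?_)
    have h3 : (toConv p.toLinearMap * toConv (S' ∘ₗ p.toLinearMap)).ofConv =
      (1 : WithConv (H →ₗ[k] H)).ofConv ∘ₗ p.toLinearMap := h1.symm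
    rw [h3]
    ext x
    simp [p, AlgHom.commutes]
  have hθ := LinearMap.algHom_comp_convMul_distrib θ (toConv i₁.toLinearMap)
    (toConv (V ∘ₗ s ∘ₗ p.toLinearMap))
  have hθ' := LinearMap.algHom_comp_convMul_distrib θ' (toConv i₁.toLinearMap)
    (toConv (V ∘ₗ s ∘ₗ p.toLinearMap))
  rw [← hsp] at hθ hθ'
  have : toConv (θ.toLinearMap ∘ₗ splitting π s) = toConv (θ'.toLinearMap ∘ₗ splitting π s) := by
    refine WithConv.ext (hθ.trans (Eq.trans ?_ hθ'.symm))
    refine congrArg WithConv.ofConv ?_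
    change toConv (θ.toLinearMap ∘ₗ i₁.toLinearMap) *
      toConv (θ.toLinearMap ∘ₗ V ∘ₗ s ∘ₗ p.toLinearMap) = _
    rw [hi, hVp, mul_assoc, ← mul_assoc (toConv (j.toLinearMap ∘ₗ p.toLinearMap)), hj, one_mul]
  exact LinearMap.congr_fun (toConv_injective this) a

end Splitting

/-! ### Opposite Hopf algebras -/

section Opposite

open Coalgebra HopfAlgebra MulOpposite

variable {k : Type*} [Field k] {A H : Type*} [Ring A] [HopfAlgebra k A] [Ring H] [HopfAlgebra k H]

theorem comul_op (a : A) : comul (R := k) (op a) =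
    TensorProduct.map (opLinearEquiv k).toLinearMap (opLinearEquiv k).toLinearMap
      (comul (R := k) a) :=
  rfl

theorem counit_op (a : A) : counit (R := k) (op a) = counit (R := k) a :=
  rfl

theorem map_op_mul (s t : A ⊗[k] A) :
    TensorProduct.map (opLinearEquiv k (M := A)).toLinearMap
        (opLinearEquiv k (M := A)).toLinearMap (s * t) =
      TensorProduct.map (opLinearEquiv k (M := A)).toLinearMap
          (opLinearEquiv k (M := A)).toLinearMap t *
        TensorProduct.map (opLinearEquiv k (M := A)).toLinearMap
          (opLinearEquiv k (M := A)).toLinearMap s := by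
  induction s with
  | zero => simp
  | add x y hx hy => simp only [map_add, add_mul, mul_add, hx, hy]
  | tmul a b =>
    induction t with
    | zero => simp
    | add x y hx hy => simp only [map_add, add_mul, mul_add, hx, hy]
    | tmul c d => simp

noncomputable instance mopBialgebra : Bialgebra k Aᵐᵒᵖ :=
  Bialgebra.mk' k Aᵐᵒᵖ
    (by rw [← op_one, counit_op, Bialgebra.counit_one])
    (by
      intro a b
      obtain ⟨a, rfl⟩ := op_surjective a
      obtain ⟨b, rfl⟩ := op_surjective b
      rw [← op_mul, counit_op, counit_op, counit_op, Bialgebra.counit_mul, mul_comm])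
    (by
      rw [← op_one, comul_op, Bialgebra.comul_one, Algebra.TensorProduct.one_def]
      rfl)
    (by
      intro a b
      obtain ⟨a, rfl⟩ := op_surjective a
      obtain ⟨b, rfl⟩ := op_surjective b
      rw [← op_mul, comul_op, comul_op, comul_op, Bialgebra.comul_mul, map_op_mul])

/-- The inverse of a bijective antipode. -/
noncomputable def antipodeInv (hA : Function.Bijective (antipode k (A := A))) : A →ₗ[k] A :=
  (LinearEquiv.ofBijective (antipode k (A := A)) hA).symm.toLinearMap

theorem antipode_antipodeInv (hA : Function.Bijective (antipode k (A := A))) (a : A) :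
    antipode k (antipodeInv hA a) = a :=
  (LinearEquiv.ofBijective (antipode k (A := A)) hA).apply_symm_apply a

/-- The opposite of a Hopf algebra with bijective antipode. -/
noncomputable abbrev mopHopfAlgebra (hA : Function.Bijective (antipode k (A := A))) :
    HopfAlgebra k Aᵐᵒᵖ where
  __ := (mopBialgebra : Bialgebra k Aᵐᵒᵖ)
  antipode := (opLinearEquiv k).toLinearMap ∘ₗ antipodeInv hA ∘ₗ (opLinearEquiv k).symm.toLinearMap
  mul_antipode_rTensor_comul := by
    ext a
    obtain ⟨a, rfl⟩ := op_surjective a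
    -- Applying S to S⁻¹(a₁) · a₂, computed in the opposite algebra as a₂ S⁻¹(a₁), gives a₁ S(a₂),
    -- which is the antipode axiom of A.
    refine unop_injective (hA.1 ?_)
    change antipode k (unop (LinearMap.mul' k Aᵐᵒᵖ (LinearMap.rTensor _ _ (comul (op a))))) =
      antipode k (unop (algebraMap k Aᵐᵒᵖ (counit (op a))))
    rw [counit_op, comul_op]
    have : ∀ t : A ⊗[k] A, antipode k (unop (LinearMap.mul' k Aᵐᵒᵖ (LinearMap.rTensor _
        ((opLinearEquiv k).toLinearMap ∘ₗ antipodeInv hA ∘ₗ (opLinearEquiv k).symm.toLinearMap)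
        (TensorProduct.map (opLinearEquiv k).toLinearMap (opLinearEquiv k).toLinearMap t)))) =
        LinearMap.mul' k A ((antipode k).lTensor A t) := by
      intro t
      induction t with
      | zero => simp
      | add x y hx hy => simp only [map_add, unop_add, hx, hy]
      | tmul a b => simp [antipode_mul_antidistrib, antipode_antipodeInv]
    rw [this]
    simp [Algebra.algebraMap_eq_smul_one]
  mul_antipode_lTensor_comul := by
    ext a
    obtain ⟨a, rfl⟩ := op_surjective a
    refine unop_injective (hA.1 ?_)
    change antipode k (unop (LinearMap.mul' k Aᵐᵒᵖ (LinearMap.lTensor _ _ (comul (op a))))) =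
      antipode k (unop (algebraMap k Aᵐᵒᵖ (counit (op a))))
    rw [counit_op, comul_op]
    have : ∀ t : A ⊗[k] A, antipode k (unop (LinearMap.mul' k Aᵐᵒᵖ (LinearMap.lTensor _
        ((opLinearEquiv k).toLinearMap ∘ₗ antipodeInv hA ∘ₗ (opLinearEquiv k).symm.toLinearMap)
        (TensorProduct.map (opLinearEquiv k).toLinearMap (opLinearEquiv k).toLinearMap t)))) =
        LinearMap.mul' k A ((antipode k).rTensor A t) := by
      intro t
      induction t with
      | zero => simp
      | add x y hx hy => simp only [map_add, unop_add, hx, hy]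
      | tmul a b => simp [antipode_mul_antidistrib, antipode_antipodeInv]
    rw [this]
    simp [Algebra.algebraMap_eq_smul_one]

/-- The opposite of a bialgebra map. -/
noncomputable def mopHom (π : A →ₐc[k] H) : Aᵐᵒᵖ →ₐc[k] Hᵐᵒᵖ :=
  .ofAlgHom (AlgHom.op (π : A →ₐ[k] H))
    (by
      ext a
      exact CoalgHomClass.counit_comp_apply π (unop a))
    (by
      ext a
      have h1 : comul (R := k) (π (unop a)) = TensorProduct.map (π : A →ₐ[k] H).toLinearMap
        (π : A →ₐ[k] H).toLinearMap (comul (unop a)) :=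
        (CoalgHomClass.map_comp_comul_apply π (unop a)).symm
      refine Eq.trans ?_ (congrArg (TensorProduct.map (opLinearEquiv k).toLinearMap
        (opLinearEquiv k).toLinearMap) h1.symm)
      change Algebra.TensorProduct.map _ _ (TensorProduct.map (opLinearEquiv k).toLinearMap
        (opLinearEquiv k).toLinearMap (comul (R := k) (unop a))) = _
      induction comul (R := k) (unop a) with
      | zero => simp
      | add x y hx hy => simp only [map_add, hx, hy]
      | tmul a b => rfl)

/-- Coinvariance involves only the comultiplication, the map and the unit, none of which changes on
passing to the opposite. -/
theorem op_mem_coinvariants {π : A →ₐc[k] H} {a : A} :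
    op a ∈ coinvariants (mopHom π) ↔ a ∈ coinvariants π := by
  let e := TensorProduct.congr (opLinearEquiv k (M := A)) (opLinearEquiv k (M := H))
  have h1 : Algebra.TensorProduct.map (AlgHom.id k Aᵐᵒᵖ) (mopHom π : Aᵐᵒᵖ →ₐ[k] Hᵐᵒᵖ)
      (comul (R := k) (op a)) = e (Algebra.TensorProduct.map (AlgHom.id k A) (π : A →ₐ[k] H)
        (comul (R := k) a)) := by
    rw [comul_op]
    induction comul (R := k) a with
    | zero => simp
    | add x y hx hy => simp only [map_add, hx, hy]
    | tmul a b => rfl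
  have h2 : (op a : Aᵐᵒᵖ) ⊗ₜ[k] (1 : Hᵐᵒᵖ) = e (a ⊗ₜ 1) := rfl
  have h3 : op a ∈ coinvariants (mopHom π) ↔
      Algebra.TensorProduct.map (AlgHom.id k Aᵐᵒᵖ) (mopHom π : Aᵐᵒᵖ →ₐ[k] Hᵐᵒᵖ)
      (comul (R := k) (op a)) = (op a : Aᵐᵒᵖ) ⊗ₜ[k] (1 : Hᵐᵒᵖ) := Iff.rfl
  rw [h3, h1, h2, e.injective.eq_iff]
  rfl

end Opposite

/-! ### Left and right splittings over the coinvariants -/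

section Splitting

open Coalgebra HopfAlgebra MulOpposite

variable {k : Type*} [Field k] {A H : Type*} [Ring A] [HopfAlgebra k A] [Ring H] [HopfAlgebra k H]

/-- The left `B`-linear splitting of the multiplication `B ⊗ A → A`, where `B = A^{co(H)}`. -/
theorem exists_left_splitting {π : A →ₐc[k] H} (hπ : Function.Surjective π) {h : H →ₗ[k] k}
    (hh : IsNormalisedIntegral h) :
    ∃ (Ψ : A →ₗ[k] A ⊗[k] A) (s : H →ₗ[k] A),
      (∀ a, Ψ a ∈ LinearMap.range ((coinvariants π).val.toLinearMap.rTensor A)) ∧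
      (∀ b ∈ coinvariants π, ∀ a, Ψ (b * a) = b ⊗ₜ 1 * Ψ a) ∧
      (∀ a, LinearMap.mul' k A (Ψ a) = a) ∧
      ∀ a, TensorProduct.lid k A ((counit (R := k) (A := A)).rTensor A (Ψ a)) = s (π a) := by
  obtain ⟨s, hs, hε⟩ := exists_leftColinear hπ hh
  refine ⟨splitting π s, s, fun a => ?_, fun b hb a => splitting_mul π s hb a,
    mul'_splitting π hε, counit_rTensor_splitting π⟩
  -- B is the kernel of `f`, and tensoring over a field is exact, so coinvariance of the first leg
  -- puts the splitting in B ⊗ A.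
  let f : A →ₗ[k] A ⊗[k] H := (rightCoaction π).toLinearMap -
    (Algebra.TensorProduct.includeLeft : A →ₐ[k] A ⊗[k] H).toLinearMap
  have hex : Function.Exact (coinvariants π).val.toLinearMap f := by
    intro x
    constructor
    · intro hx
      exact ⟨⟨x, mem_coinvariants.2 (sub_eq_zero.1 hx)⟩, rfl⟩
    · rintro ⟨x, rfl⟩
      exact sub_eq_zero.2 (mem_coinvariants.1 x.2)
  refine (Module.Flat.rTensor_exact A hex _).1 ?_
  rw [LinearMap.rTensor_sub, LinearMap.sub_apply, sub_eq_zero]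
  exact coaction_splitting π hs a

/-- The right `B`-linear splitting of the multiplication `A ⊗ B → A`, where `B = A^{co(H)}`; the
tensor factors are interchanged. -/
theorem exists_right_splitting (hA : Function.Bijective (antipode k (A := A)))
    (hH : Function.Bijective (antipode k (A := H))) {π : A →ₐc[k] H}
    (hπ : Function.Surjective π) {h : H →ₗ[k] k} (hh : IsNormalisedIntegral h) :
    ∃ (Ψ : A →ₗ[k] A ⊗[k] A) (s : H →ₗ[k] A),
      (∀ a, Ψ a ∈ LinearMap.range ((coinvariants π).val.toLinearMap.rTensor A)) ∧
      (∀ b ∈ coinvariants π, ∀ a, Ψ (a * b) = Ψ a * b ⊗ₜ 1) ∧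
      (∀ a, LinearMap.mul' k A (TensorProduct.comm k A A (Ψ a)) = a) ∧
      ∀ a, TensorProduct.lid k A ((counit (R := k) (A := A)).rTensor A (Ψ a)) = s (π a) := by
  -- In the opposite algebra, left multiplication by B becomes right multiplication, while integrals
  -- and coinvariants stay the same.
  let iA : HopfAlgebra k Aᵐᵒᵖ := mopHopfAlgebra hA
  let iH : HopfAlgebra k Hᵐᵒᵖ := mopHopfAlgebra hH
  let π' : Aᵐᵒᵖ →ₐc[k] Hᵐᵒᵖ := mopHom π
  have hπ' : Function.Surjective π' := fun y => by
    obtain ⟨x, hx⟩ := hπ (unop y)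
    exact ⟨op x, congrArg op hx⟩
  have hh' : IsNormalisedIntegral (h ∘ₗ (opLinearEquiv k (M := H)).symm.toLinearMap) :=
    { map_one := hh.map_one
      rid_lTensor_comul := fun y => by
        obtain ⟨y, rfl⟩ := op_surjective y
        refine Eq.trans ?_ (congrArg (opLinearEquiv k (M := H)) (hh.rid_lTensor_comul y))
        change TensorProduct.rid k Hᵐᵒᵖ (LinearMap.lTensor _ _ (TensorProduct.map
          (opLinearEquiv k).toLinearMap (opLinearEquiv k).toLinearMap (comul (R := k) y))) = _
        induction comul (R := k) y with
        | zero => simp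
        | add x y hx hy => simp only [map_add, hx, hy]
        | tmul a b => simp }
  obtain ⟨Ψ, s, h1, h2, h3, h4⟩ := exists_left_splitting hπ' hh'
  let u : Aᵐᵒᵖ →ₗ[k] A := (opLinearEquiv k (M := A)).symm.toLinearMap
  let U : Aᵐᵒᵖ ⊗[k] Aᵐᵒᵖ →ₗ[k] A ⊗[k] A := TensorProduct.map u u
  refine ⟨U ∘ₗ Ψ ∘ₗ (opLinearEquiv k).toLinearMap, u ∘ₗ s ∘ₗ (opLinearEquiv k).toLinearMap,
    fun a => ?_, fun b hb a => ?_, fun a => ?_, fun a => ?_⟩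
  · obtain ⟨t, ht⟩ := h1 (op a)
    change U (Ψ (op a)) ∈ _
    rw [← ht]
    clear ht
    induction t with
    | zero => simp
    | add x y hx hy => simpa only [map_add] using add_mem hx hy
    | tmul b c => exact ⟨⟨unop (b : Aᵐᵒᵖ), op_mem_coinvariants.1 b.2⟩ ⊗ₜ unop c, rfl⟩
  · have h5 := h2 (op b) (op_mem_coinvariants.2 hb) (op a)
    change U (Ψ (op b * op a)) = U (Ψ (op a)) * _
    rw [h5]
    induction Ψ (op a) with
    | zero => simp
    | add x y hx hy => simp only [map_add, mul_add, add_mul, hx, hy]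
    | tmul x y => simp [U, u]
  · have h5 : ∀ t : Aᵐᵒᵖ ⊗[k] Aᵐᵒᵖ, LinearMap.mul' k A (TensorProduct.comm k A A (U t)) =
        u (LinearMap.mul' k Aᵐᵒᵖ t) := by
      intro t
      induction t with
      | zero => simp
      | add x y hx hy => simp only [map_add, hx, hy]
      | tmul x y => simp [U, u]
    exact (h5 _).trans (congrArg unop (h3 (op a)))
  · have h5 : ∀ t : Aᵐᵒᵖ ⊗[k] Aᵐᵒᵖ, TensorProduct.lid k A
        ((counit (R := k) (A := A)).rTensor A (U t)) =
        u (TensorProduct.lid k Aᵐᵒᵖ ((counit (R := k) (A := Aᵐᵒᵖ)).rTensor Aᵐᵒᵖ t)) := by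
      intro t
      induction t with
      | zero => simp
      | add x y hx hy => simp only [map_add, hx, hy]
      | tmul x y => rfl
    exact (h5 _).trans (congrArg unop (h4 (op a)))

end Splitting

/-! ### Faithful flatness from splittings -/

section Exactness

/-- A retract of an exact sequence is exact. It serves twice: A ⊗_B M is a natural retract of A ⊗ M,
and M is a natural retract of A ⊗_B M. -/
theorem exact_of_retract {L M N L' M' N' : Type*} [Zero N] [Zero N'] {f : L → M} {g : M → N}
    {f' : L' → M'} {g' : M' → N'} {iL : L → L'} {iM : M → M'} {iN : N → N'} {rL : L' → L}
    {rM : M' → M} {rN : N' → N} (hiN : iN 0 = 0) (hM : ∀ x, rM (iM x) = x)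
    (hN : ∀ x, rN (iN x) = x) (hf : ∀ x, iM (f x) = f' (iL x)) (hg : ∀ x, iN (g x) = g' (iM x))
    (hf' : ∀ x, rM (f' x) = f (rL x)) (h : Function.Exact f' g') : Function.Exact f g := by
  intro y
  constructor
  · intro hy
    obtain ⟨x, hx⟩ := (h (iM y)).1 (by rw [← hg, hy, hiN])
    exact ⟨rL x, by rw [← hf', hx, hM]⟩
  · rintro ⟨x, rfl⟩
    have h0 : iN (g (f x)) = 0 := by
      rw [hg, hf]
      exact (h _).2 ⟨_, rfl⟩
    rw [← hN (g (f x)), h0, ← hiN, hN]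

end Exactness

section FaithfulFlatness

variable {k : Type*} {A : Type u} [Field k] [Ring A] [Algebra k A] {B : Subalgebra k A}

/-- If `A` is a direct summand of a free right `B`-module and `B` is a direct summand of `A` as a
right `B`-module, then `A` is faithfully flat over `B`. -/
theorem isRightFaithfullyFlat_of_splitting (Ψ : A →ₗ[k] A ⊗[k] A)
    (hΨ : ∀ a, Ψ a ∈ LinearMap.range (B.val.toLinearMap.rTensor A))
    (hΨ_mul : ∀ b ∈ B, ∀ a, Ψ (a * b) = Ψ a * b ⊗ₜ 1)
    (hΨ_id : ∀ a, LinearMap.mul' k A (TensorProduct.comm k A A (Ψ a)) = a)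
    (E : A →ₗ[k] B) (hE : ∀ a (b : B), E (a * b) = E a * b) (hE1 : E 1 = 1) :
    IsRightFaithfullyFlat B := by
  let ι : B ⊗[k] A →ₗ[k] A ⊗[k] A := B.val.toLinearMap.rTensor A
  have hι : Function.Injective ι :=
    Module.Flat.rTensor_preserves_injective_linearMap (M := A) B.val.toLinearMap
      Subtype.val_injective
  -- `q` serves only to regard `Ψ` as a map `Φ` into B ⊗ A.
  obtain ⟨q, hq⟩ := ι.exists_leftInverse_of_injective (LinearMap.ker_eq_bot.2 hι)
  let Φ : A →ₗ[k] B ⊗[k] A := q ∘ₗ Ψ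
  have hΦ : ∀ a, ι (Φ a) = Ψ a := by
    intro a
    obtain ⟨t, ht⟩ := hΨ a
    change ι (q (Ψ a)) = _
    rw [← ht]
    exact congrArg ι (LinearMap.congr_fun hq t)
  have hΦ_mul : ∀ a (b : B), Φ (a * b) = (LinearMap.mulRight k b).rTensor A (Φ a) := by
    intro a b
    apply hι
    rw [hΦ, hΨ_mul b b.2, ← hΦ]
    induction Φ a with
    | zero => simp
    | add x y hx hy => simp only [map_add, add_mul, hx, hy]
    | tmul x y => simp [ι]
  intro L M N _ _ _ _ _ _ _ _ _ _ _ _ f g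
  -- the action of `B ⊗ A` on `M`
  let T (M : Type u) [AddCommGroup M] [Module k M] [Module B M] [IsScalarTower k B M] :
      B ⊗[k] A →ₗ[k] M →ₗ[k] A ⊗[k] M :=
    TensorProduct.lift <| LinearMap.mk₂ k
      (fun b v => TensorProduct.mk k A M v ∘ₗ Algebra.lsmul k k M b)
      (fun b b' v => by ext; simp [TensorProduct.tmul_add])
      (fun c b v => by ext; simp)
      (fun b v v' => by ext; simp)
      (fun c b v => by ext; simp [TensorProduct.smul_tmul'])
  have hT : ∀ (M : Type u) [AddCommGroup M] [Module k M] [Module B M] [IsScalarTower k B M]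
      (b : B) (v : A) (m : M), T M (b ⊗ₜ v) m = v ⊗ₜ (b • m) := fun M _ _ _ _ b v m => rfl
  -- If Φ(a) = ∑ b ⊗ v, then ψ(a ⊗ m) = ∑ v ⊗ bm. Right B-linearity of `Φ` makes it balanced, and ∑
  -- vb = a makes the quotient map a left inverse of it.
  let ψ (M : Type u) [AddCommGroup M] [Module k M] [Module B M] [IsScalarTower k B M] :
      TensorOver B M →ₗ[k] A ⊗[k] M :=
    (balancingSubmodule B M).liftQ (TensorProduct.lift (T M ∘ₗ Φ)) (by
      rw [balancingSubmodule, Submodule.span_le]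
      rintro _ ⟨a, b, m, rfl⟩
      rw [SetLike.mem_coe, LinearMap.mem_ker, map_sub, sub_eq_zero]
      simp only [TensorProduct.lift.tmul, LinearMap.comp_apply, hΦ_mul]
      induction Φ a with
      | zero => simp
      | add x y hx hy => simp only [map_add, LinearMap.add_apply, hx, hy]
      | tmul x y => simp [hT, mul_smul])
  have hψ : ∀ (M : Type u) [AddCommGroup M] [Module k M] [Module B M] [IsScalarTower k B M]
      (a : A) (m : M), ψ M (Submodule.Quotient.mk (a ⊗ₜ m)) = T M (Φ a) m :=
    fun M _ _ _ _ a m => rfl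
  have hψ_id : ∀ (M : Type u) [AddCommGroup M] [Module k M] [Module B M] [IsScalarTower k B M]
      (x : TensorOver B M), (balancingSubmodule B M).mkQ (ψ M x) = x := by
    intro M _ _ _ _ x
    obtain ⟨x, rfl⟩ := Submodule.Quotient.mk_surjective _ x
    induction x with
    | zero => simp
    | add x y hx hy => rw [Submodule.Quotient.mk_add, map_add, map_add, hx, hy]
    | tmul a m =>
      have h1 : ∀ t : B ⊗[k] A, (balancingSubmodule B M).mkQ (T M t m) =
          Submodule.Quotient.mk
            ((LinearMap.mul' k A (TensorProduct.comm k A A (ι t))) ⊗ₜ[k] m) := by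
        intro t
        induction t with
        | zero => simp
        | add x y hx hy =>
          simp only [map_add, LinearMap.add_apply, hx, hy, TensorProduct.add_tmul,
            Submodule.Quotient.mk_add]
        | tmul b v =>
          rw [hT, Submodule.mkQ_apply]
          have h2 : (v * (b : A)) ⊗ₜ[k] m - v ⊗ₜ[k] (b • m) ∈ balancingSubmodule B M :=
            Submodule.subset_span ⟨v, b, m, rfl⟩
          exact ((Submodule.Quotient.eq _).2 h2).symm
      rw [hψ, h1, hΦ, hΨ_id]
  have hψ_nat : ∀ (M N : Type u) [AddCommGroup M] [Module k M] [Module B M] [IsScalarTower k B M]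
      [AddCommGroup N] [Module k N] [Module B N] [IsScalarTower k B N] (f : M →ₗ[B] N)
      (x : TensorOver B M),
      ψ N (TensorOver.map B f x) = (f.restrictScalars k).lTensor A (ψ M x) := by
    intro M N _ _ _ _ _ _ _ _ f x
    obtain ⟨x, rfl⟩ := Submodule.Quotient.mk_surjective _ x
    induction x with
    | zero => simp
    | add x y hx hy => simp only [Submodule.Quotient.mk_add, map_add, hx, hy]
    | tmul a m =>
      change T N (Φ a) (f m) = LinearMap.lTensor A _ (T M (Φ a) m)
      induction Φ a with
      | zero => simp
      | add x y hx hy => simp only [map_add, LinearMap.add_apply, hx, hy]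
      | tmul x y => simp [hT]
  -- the Reynolds operator gives a natural retraction of `m ↦ 1 ⊗ m`
  let r (M : Type u) [AddCommGroup M] [Module k M] [Module B M] [IsScalarTower k B M] :
      TensorOver B M →ₗ[k] M :=
    (balancingSubmodule B M).liftQ
      (TensorProduct.lift ((Algebra.lsmul k k M).toLinearMap ∘ₗ E)) (by
        rw [balancingSubmodule, Submodule.span_le]
        rintro _ ⟨a, b, m, rfl⟩
        simp [hE])
  let i (M : Type u) [AddCommGroup M] [Module k M] [Module B M] [IsScalarTower k B M] (m : M) :
      TensorOver B M := Submodule.Quotient.mk (1 ⊗ₜ m)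
  have hr : ∀ (M : Type u) [AddCommGroup M] [Module k M] [Module B M] [IsScalarTower k B M]
      (a : A) (m : M), r M (Submodule.Quotient.mk (a ⊗ₜ m)) = E a • m := fun M _ _ _ _ a m => rfl
  have hr_id : ∀ (M : Type u) [AddCommGroup M] [Module k M] [Module B M] [IsScalarTower k B M]
      (m : M), r M (i M m) = m := by
    intro M _ _ _ _ m
    rw [hr, hE1, one_smul]
  have hr_nat : ∀ (M N : Type u) [AddCommGroup M] [Module k M] [Module B M] [IsScalarTower k B M]
      [AddCommGroup N] [Module k N] [Module B N] [IsScalarTower k B N] (f : M →ₗ[B] N)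
      (x : TensorOver B M), r N (TensorOver.map B f x) = f (r M x) := by
    intro M N _ _ _ _ _ _ _ _ f x
    obtain ⟨x, rfl⟩ := Submodule.Quotient.mk_surjective _ x
    induction x with
    | zero => simp
    | add x y hx hy => simp only [Submodule.Quotient.mk_add, map_add, hx, hy]
    | tmul a m =>
      rw [hr, map_smul]
      rfl
  constructor
  · intro h
    have h' : Function.Exact ((f.restrictScalars k).lTensor A) ((g.restrictScalars k).lTensor A) :=
      Module.Flat.lTensor_exact A h
    exact exact_of_retract (map_zero (ψ N)) (hψ_id M) (hψ_id N) (hψ_nat L M f) (hψ_nat M N g)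
      (rL := (balancingSubmodule B L).mkQ) (fun x => rfl) h'
  · intro h
    exact exact_of_retract (iL := i L) (iM := i M) (iN := i N) (rL := r L) (rM := r M) (rN := r N)
      (by simp [i]) (hr_id M) (hr_id N) (fun x => rfl) (fun x => rfl) (hr_nat L M f) h

end FaithfulFlatness

/-! ### Coinvariants as quantum homogeneous spaces -/

section HomogeneousSpaces

open Coalgebra HopfAlgebra

variable {k : Type*} [Field k] {A : Type u} {H : Type v} [Ring A] [HopfAlgebra k A] [Ring H]
  [HopfAlgebra k H]

theorem rTensor_rightCoaction_rightCoaction (π : A →ₐc[k] H) (a : A) :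
    (rightCoaction π).toLinearMap.rTensor H (rightCoaction π a) =
      (TensorProduct.assoc k A H H).symm
        ((comul (R := k) (A := H)).lTensor A (rightCoaction π a)) := by
  let p : A →ₗ[k] H := (π : A →ₐ[k] H).toLinearMap
  have h1 : ∀ t : A ⊗[k] A, (rightCoaction π).toLinearMap.rTensor H (p.lTensor A t) =
      TensorProduct.map (p.lTensor A) p ((comul (R := k) (A := A)).rTensor A t) := by
    intro t
    induction t with
    | zero => simp
    | add x y hx hy => simp only [map_add, hx, hy]
    | tmul x y => rfl
  have h2 : ∀ t : A ⊗[k] A,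
      (TensorProduct.assoc k A H H).symm ((comul (R := k) (A := H)).lTensor A (p.lTensor A t)) =
      TensorProduct.map (p.lTensor A) p
        ((TensorProduct.assoc k A A A).symm ((comul (R := k) (A := A)).lTensor A t)) := by
    intro t
    induction t with
    | zero => simp
    | add x y hx hy => simp only [map_add, hx, hy]
    | tmul x y =>
      have h3 : comul (R := k) (p y) = TensorProduct.map p p (comul y) :=
        (CoalgHomClass.map_comp_comul_apply π y).symm
      simp only [LinearMap.lTensor_tmul, h3]
      induction (comul (R := k) y) with
      | zero => simp
      | add x y hx hy => simp only [map_add, TensorProduct.tmul_add, hx, hy]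
      | tmul x y => simp
  rw [rightCoaction_apply]
  change (rightCoaction π).toLinearMap.rTensor H (p.lTensor A _) =
    (TensorProduct.assoc k A H H).symm ((comul (R := k) (A := H)).lTensor A (p.lTensor A _))
  rw [h1, h2, coassoc_symm_apply]

/-- The map `a ↦ a₍₁₎ h(π(a₍₂₎))`. -/
noncomputable def reynolds (π : A →ₐc[k] H) (h : H →ₗ[k] k) : A →ₗ[k] A :=
  (TensorProduct.rid k A).toLinearMap ∘ₗ h.lTensor A ∘ₗ (rightCoaction π).toLinearMap

/-- Coacting on a₁ h(π(a₂)) gives a₁ ⊗ π(a₂) h(π(a₃)) by coassociativity, and the integral property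
turns the second leg into h(π(a₂)) 1. -/
theorem reynolds_mem {h : H →ₗ[k] k} (hh : IsNormalisedIntegral h) (π : A →ₐc[k] H) (a : A) :
    reynolds π h a ∈ coinvariants π := by
  rw [mem_coinvariants]
  have h1 : ∀ t : A ⊗[k] H,
      rightCoaction π (TensorProduct.rid k A (h.lTensor A t)) =
        TensorProduct.rid k (A ⊗[k] H)
          (h.lTensor (A ⊗[k] H) ((rightCoaction π).toLinearMap.rTensor H t)) := by
    intro t
    induction t with
    | zero => simp
    | add x y hx hy => simp only [map_add, hx, hy]
    | tmul x y => simp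
  have h2 : ∀ t : A ⊗[k] H, TensorProduct.rid k (A ⊗[k] H) (h.lTensor (A ⊗[k] H)
      ((TensorProduct.assoc k A H H).symm ((comul (R := k) (A := H)).lTensor A t))) =
      TensorProduct.rid k A (h.lTensor A t) ⊗ₜ 1 := by
    intro t
    induction t with
    | zero => simp
    | add x y hx hy => simp only [map_add, TensorProduct.add_tmul, hx, hy]
    | tmul x y =>
      have h3 : ∀ w : H ⊗[k] H, TensorProduct.rid k (A ⊗[k] H) (h.lTensor (A ⊗[k] H)
          ((TensorProduct.assoc k A H H).symm (x ⊗ₜ w))) =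
          x ⊗ₜ TensorProduct.rid k H (h.lTensor H w) := by
        intro w
        induction w with
        | zero => simp
        | add x y hx hy => simp only [map_add, TensorProduct.tmul_add, hx, hy]
        | tmul x y => simp
      rw [LinearMap.lTensor_tmul, h3, hh.rid_lTensor_comul]
      simp [TensorProduct.smul_tmul']
  refine (h1 _).trans ?_
  rw [AlgHom.toLinearMap_apply, rTensor_rightCoaction_rightCoaction]
  exact h2 _

theorem reynolds_mul (π : A →ₐc[k] H) (h : H →ₗ[k] k) (a : A) {b : A}
    (hb : b ∈ coinvariants π) : reynolds π h (a * b) = reynolds π h a * b := by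
  have h1 : ∀ t : A ⊗[k] H, TensorProduct.rid k A (h.lTensor A (t * b ⊗ₜ 1)) =
      TensorProduct.rid k A (h.lTensor A t) * b := by
    intro t
    induction t with
    | zero => simp
    | add x y hx hy => simp only [map_add, add_mul, hx, hy]
    | tmul x y => simp
  change TensorProduct.rid k A (h.lTensor A (rightCoaction π (a * b))) = _
  rw [map_mul, mem_coinvariants.1 hb]
  exact h1 _

theorem reynolds_one {h : H →ₗ[k] k} (hh : IsNormalisedIntegral h) (π : A →ₐc[k] H) :
    reynolds π h 1 = 1 := by
  change TensorProduct.rid k A (h.lTensor A (rightCoaction π 1)) = _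
  rw [map_one, Algebra.TensorProduct.one_def]
  simp [hh.map_one]

/-- The coinvariants are a kernel, so over a field membership in A ⊗ B can be tested by coacting on
the second leg. Coassociativity reduces that test to coinvariance of `b`. -/
theorem comul_mem_of_mem_coinvariants (π : A →ₐc[k] H) {b : A} (hb : b ∈ coinvariants π) :
    comul (R := k) b ∈
      LinearMap.range ((Subalgebra.toSubmodule (coinvariants π)).subtype.lTensor A) := by
  let p : A →ₗ[k] H := (π : A →ₐ[k] H).toLinearMap
  let i : A →ₗ[k] A ⊗[k] H := (TensorProduct.mk k A H).flip 1
  let f : A →ₗ[k] A ⊗[k] H := (rightCoaction π).toLinearMap - i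
  have hex : Function.Exact (Subalgebra.toSubmodule (coinvariants π)).subtype f := by
    intro x
    constructor
    · intro hx
      exact ⟨⟨x, mem_coinvariants.2 (sub_eq_zero.1 hx)⟩, rfl⟩
    · rintro ⟨x, rfl⟩
      exact sub_eq_zero.2 (mem_coinvariants.1 x.2)
  refine (Module.Flat.lTensor_exact A hex _).1 ?_
  rw [LinearMap.lTensor_sub, LinearMap.sub_apply, sub_eq_zero]
  have h1 : ∀ t : A ⊗[k] A, i.lTensor A t =
      TensorProduct.assoc k A A H (t ⊗ₜ 1) := by
    intro t
    induction t with
    | zero => simp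
    | add x y hx hy => simp only [map_add, TensorProduct.add_tmul, hx, hy]
    | tmul x y => rfl
  have h2 : (rightCoaction π).toLinearMap.lTensor A (comul b) =
      (p.lTensor A).lTensor A ((comul (R := k) (A := A)).lTensor A (comul b)) := by
    exact LinearMap.congr_fun (LinearMap.lTensor_comp A (p.lTensor A) comul) (comul b)
  have h3 : ∀ t : A ⊗[k] A, (p.lTensor A).lTensor A
      (TensorProduct.assoc k A A A ((comul (R := k) (A := A)).rTensor A t)) =
      TensorProduct.assoc k A A H ((comul (R := k) (A := A)).rTensor H (p.lTensor A t)) := by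
    intro t
    induction t with
    | zero => simp
    | add x y hx hy => simp only [map_add, hx, hy]
    | tmul x y =>
      simp only [LinearMap.rTensor_tmul, LinearMap.lTensor_tmul]
      induction comul (R := k) x with
      | zero => simp
      | add x y hx hy => simp only [map_add, TensorProduct.add_tmul, hx, hy]
      | tmul x y => simp
  have h4 : p.lTensor A (comul b) = b ⊗ₜ 1 := mem_coinvariants.1 hb
  rw [h1, h2, ← coassoc_apply, h3, h4, LinearMap.rTensor_tmul]

theorem map_eq_counit_of_mem_coinvariants (π : A →ₐc[k] H) {b : A} (hb : b ∈ coinvariants π) :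
    π b = counit (R := k) b • (1 : H) := by
  have h1 : ∀ t : A ⊗[k] A, TensorProduct.lid k H ((counit (R := k) (A := A)).rTensor H
      ((π : A →ₐ[k] H).toLinearMap.lTensor A t)) =
      π (TensorProduct.lid k A ((counit (R := k) (A := A)).rTensor A t)) := by
    intro t
    induction t with
    | zero => simp
    | add x y hx hy => simp only [map_add, hx, hy]
    | tmul x y => simp
  have h2 := h1 (comul b)
  rw [← rightCoaction_apply, mem_coinvariants.1 hb] at h2
  simpa using h2.symm

theorem map_eq_zero_of_mem_augmentation (π : A →ₐc[k] H) {b : A}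
    (hb : b ∈ augmentation (coinvariants π)) : π b = 0 := by
  rw [map_eq_counit_of_mem_coinvariants π hb.1, show counit (R := k) b = 0 from hb.2, zero_smul]

theorem sub_counit_mem_augmentation {B : Subalgebra k A} (b : B) :
    (b : A) - counit (R := k) (b : A) • 1 ∈ augmentation B := by
  refine ⟨sub_mem b.2 (Submodule.smul_mem _ _ (one_mem B)), ?_⟩
  simp

/-- A coinvariant b has π(b) = ε(b) 1, so B⁺ dies under `π`. Conversely, write the splitting of a as
∑ b ⊗ v; if π(a) = 0, then ∑ ε(b)v = s(π(a)) = 0, so a = ∑ (b - ε(b))v. -/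
theorem augmentation_mul_top_eq_ker {π : A →ₐc[k] H} (hπ : Function.Surjective π)
    {h : H →ₗ[k] k} (hh : IsNormalisedIntegral h) :
    augmentation (coinvariants π) * ⊤ = LinearMap.ker (π : A →ₐ[k] H).toLinearMap := by
  apply le_antisymm
  · rw [Submodule.mul_le]
    intro b hb a _
    have : π (b * a) = 0 := by rw [map_mul, map_eq_zero_of_mem_augmentation π hb, zero_mul]
    exact this
  · intro a ha
    obtain ⟨Ψ, s, h1, -, h3, h4⟩ := exists_left_splitting hπ hh
    obtain ⟨t, ht⟩ := h1 a
    have h5 : ∀ t : coinvariants π ⊗[k] A,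
        LinearMap.mul' k A ((coinvariants π).val.toLinearMap.rTensor A t) -
          TensorProduct.lid k A ((counit (R := k) (A := A)).rTensor A
            ((coinvariants π).val.toLinearMap.rTensor A t)) ∈
        augmentation (coinvariants π) * (⊤ : Submodule k A) := by
      intro t
      induction t with
      | zero => simp
      | add x y hx hy => simpa only [map_add, add_sub_add_comm] using add_mem hx hy
      | tmul b v =>
        have := Submodule.mul_mem_mul (sub_counit_mem_augmentation b)
          (Submodule.mem_top (R := k) (x := v))
        simpa [sub_mul] using this
    have h6 := h5 t
    have h7 : π a = 0 := ha
    rwa [ht, h3, h4, h7, map_zero, sub_zero] at h6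

theorem top_mul_augmentation_eq_ker (hA : Function.Bijective (antipode k (A := A)))
    (hH : Function.Bijective (antipode k (A := H))) {π : A →ₐc[k] H}
    (hπ : Function.Surjective π) {h : H →ₗ[k] k} (hh : IsNormalisedIntegral h) :
    ⊤ * augmentation (coinvariants π) = LinearMap.ker (π : A →ₐ[k] H).toLinearMap := by
  apply le_antisymm
  · rw [Submodule.mul_le]
    intro a _ b hb
    have : π (a * b) = 0 := by rw [map_mul, map_eq_zero_of_mem_augmentation π hb, mul_zero]
    exact this
  · intro a ha
    obtain ⟨Ψ, s, h1, -, h3, h4⟩ := exists_right_splitting hA hH hπ hh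
    obtain ⟨t, ht⟩ := h1 a
    have h5 : ∀ t : coinvariants π ⊗[k] A,
        LinearMap.mul' k A (TensorProduct.comm k A A
          ((coinvariants π).val.toLinearMap.rTensor A t)) -
          TensorProduct.lid k A ((counit (R := k) (A := A)).rTensor A
            ((coinvariants π).val.toLinearMap.rTensor A t)) ∈
        (⊤ : Submodule k A) * augmentation (coinvariants π) := by
      intro t
      induction t with
      | zero => simp
      | add x y hx hy => simpa only [map_add, add_sub_add_comm] using add_mem hx hy
      | tmul b v =>
        have := Submodule.mul_mem_mul (Submodule.mem_top (R := k) (x := v))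
          (sub_counit_mem_augmentation b)
        simpa [mul_sub] using this
    have h6 := h5 t
    have h7 : π a = 0 := ha
    rwa [ht, h3, h4, h7, map_zero, sub_zero] at h6

theorem isQuantumHomogeneousSpace_coinvariants (hA : Function.Bijective (antipode k (A := A)))
    (hH : Function.Bijective (antipode k (A := H))) {π : A →ₐc[k] H}
    (hπ : Function.Surjective π) {h : H →ₗ[k] k} (hh : IsNormalisedIntegral h) :
    IsQuantumHomogeneousSpace (coinvariants π) where
  comul_mem _ := comul_mem_of_mem_coinvariants π
  isRightFaithfullyFlat := by
    obtain ⟨Ψ, -, h1, h2, h3, -⟩ := exists_right_splitting hA hH hπ hh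
    let E : A →ₗ[k] coinvariants π :=
      { toFun := fun a => ⟨reynolds π h a, reynolds_mem hh π a⟩
        map_add' := fun a b => Subtype.ext (map_add _ a b)
        map_smul' := fun c a => Subtype.ext (map_smul _ c a) }
    exact isRightFaithfullyFlat_of_splitting Ψ h1 h2 h3 E
      (fun a b => Subtype.ext (reynolds_mul π h a b.2)) (Subtype.ext (reynolds_one hh π))
  augmentation_mul_top := by
    rw [augmentation_mul_top_eq_ker hπ hh, top_mul_augmentation_eq_ker hA hH hπ hh]

theorem mem_augIdeal_coinvariants (hA : Function.Bijective (antipode k (A := A)))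
    (hH : Function.Bijective (antipode k (A := H))) {π : A →ₐc[k] H}
    (hπ : Function.Surjective π) {h : H →ₗ[k] k} (hh : IsNormalisedIntegral h) {a : A} :
    a ∈ augIdeal (coinvariants π) ↔ π a = 0 := by
  rw [← Submodule.restrictScalars_mem k, restrictScalars_augIdeal,
    top_mul_augmentation_eq_ker hA hH hπ hh]
  rfl

end HomogeneousSpaces

/-! ### Cosemisimple coalgebras -/

section Cosemisimple

open Coalgebra

variable {k : Type*} {C : Type*} [Field k] [AddCommGroup C] [Module k C] [Coalgebra k C]

theorem IsCosemisimple.linearMap_ext {M : Type*} [AddCommGroup M] [Module k M]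
    (hcs : IsCosemisimple k C) {f g : C →ₗ[k] M}
    (h : ∀ D : Submodule k C, IsSimpleSubcoalgebra D → ∀ x ∈ D, f x = g x) : f = g := by
  have h1 : (⊤ : Submodule k C) ≤ LinearMap.eqLocus f g := by
    rw [← hcs.sSup_eq_top]
    exact sSup_le fun D hD x hx => h D hD x hx
  ext x
  exact h1 Submodule.mem_top

/-- In a cosemisimple coalgebra, the counit can be restricted to the sum of an arbitrary set of
simple subcoalgebras and extended by zero on the others. -/
theorem IsCosemisimple.exists_functional (hcs : IsCosemisimple k C) (T : Set (Submodule k C)) :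
    ∃ φ : C →ₗ[k] k, ∀ D : Submodule k C, IsSimpleSubcoalgebra D →
      (D ∈ T → ∀ x ∈ D, φ x = counit x) ∧ (D ∉ T → ∀ x ∈ D, φ x = 0) := by
  let ι := {D : Submodule k C // IsSimpleSubcoalgebra D}
  have hind : iSupIndep (fun D : ι => D.1) := (sSupIndep_iff _).1 hcs.indep
  let s : Set ι := {D | D.1 ∈ T}
  have hc : IsCompl (⨆ D ∈ s, D.1) (⨆ D ∈ sᶜ, D.1) := by
    refine ⟨hind.disjoint_biSup_biSup disjoint_compl_right, codisjoint_iff.2 (top_le_iff.1 ?_)⟩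
    rw [← hcs.sSup_eq_top]
    refine sSup_le fun D hD => ?_
    by_cases h : D ∈ T
    · exact le_sup_of_le_left (le_biSup (fun D : ι => D.1) (show (⟨D, hD⟩ : ι) ∈ s from h))
    · exact le_sup_of_le_right (le_biSup (fun D : ι => D.1) (show (⟨D, hD⟩ : ι) ∈ sᶜ from h))
  refine ⟨LinearMap.ofIsCompl hc (counit ∘ₗ Submodule.subtype _) 0, fun D hD => ⟨fun h x hx => ?_,
    fun h x hx => ?_⟩⟩
  · have h1 : x ∈ ⨆ D ∈ s, D.1 :=
      le_biSup (fun D : ι => D.1) (show (⟨D, hD⟩ : ι) ∈ s from h) hx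
    exact LinearMap.ofIsCompl_apply_left hc ⟨x, h1⟩
  · have h1 : x ∈ ⨆ D ∈ sᶜ, D.1 :=
      le_biSup (fun D : ι => D.1) (show (⟨D, hD⟩ : ι) ∈ sᶜ from h) hx
    exact LinearMap.ofIsCompl_apply_right hc ⟨x, h1⟩

theorem IsSubcoalgebra.rid_lTensor_congr {D : Submodule k C} (hD : IsSubcoalgebra D)
    {f g : C →ₗ[k] k} (h : ∀ x ∈ D, f x = g x) {x : C} (hx : x ∈ D) :
    TensorProduct.rid k C (f.lTensor C (comul x)) =
      TensorProduct.rid k C (g.lTensor C (comul x)) := by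
  obtain ⟨t, ht⟩ := hD x hx
  rw [← ht]
  clear ht
  induction t with
  | zero => simp
  | add x y hx hy => simp only [map_add, hx, hy]
  | tmul x y => simp [h y y.2]

theorem IsSubcoalgebra.rid_lTensor_eq_self {D : Submodule k C} (hD : IsSubcoalgebra D)
    {f : C →ₗ[k] k} (h : ∀ x ∈ D, f x = counit x) {x : C} (hx : x ∈ D) :
    TensorProduct.rid k C (f.lTensor C (comul x)) = x := by
  rw [hD.rid_lTensor_congr h hx]
  simp

theorem IsSubcoalgebra.rid_lTensor_eq_zero {D : Submodule k C} (hD : IsSubcoalgebra D)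
    {f : C →ₗ[k] k} (h : ∀ x ∈ D, f x = 0) {x : C} (hx : x ∈ D) :
    TensorProduct.rid k C (f.lTensor C (comul x)) = 0 := by
  rw [hD.rid_lTensor_congr (g := 0) h hx]
  simp

theorem isSubcoalgebra_map {D : Submodule k C} (hD : IsSubcoalgebra D) {f : C →ₗ[k] C}
    (hf : ∀ x, comul (R := k) (f x) = TensorProduct.map f f (comul x)) :
    IsSubcoalgebra (D.map f) := by
  rintro _ ⟨x, hx, rfl⟩
  obtain ⟨t, ht⟩ := hD x hx
  rw [hf, ← ht]
  clear ht
  induction t with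
  | zero => simp
  | add x y hx hy => simpa only [map_add] using add_mem hx hy
  | tmul x y =>
    exact ⟨⟨f x, Submodule.mem_map_of_mem x.2⟩ ⊗ₜ ⟨f y, Submodule.mem_map_of_mem y.2⟩, rfl⟩

/-- Coalgebra automorphisms permute the simple subcoalgebras; this is applied to multiplication by a
grouplike element. -/
theorem isSimpleSubcoalgebra_map {D : Submodule k C} (hD : IsSimpleSubcoalgebra D)
    {f g : C →ₗ[k] C} (hf : ∀ x, comul (R := k) (f x) = TensorProduct.map f f (comul x))
    (hg : ∀ x, comul (R := k) (g x) = TensorProduct.map g g (comul x))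
    (hfg : f ∘ₗ g = LinearMap.id) (hgf : g ∘ₗ f = LinearMap.id) :
    IsSimpleSubcoalgebra (D.map f) where
  isSubcoalgebra := isSubcoalgebra_map hD.isSubcoalgebra hf
  ne_bot h := hD.ne_bot <| by
    rw [← Submodule.map_id D, ← hgf, Submodule.map_comp, h, Submodule.map_bot]
  eq_bot_or_eq E hE hED := by
    have h1 : E.map g ≤ D := by
      refine (Submodule.map_mono hED).trans ?_
      rw [← Submodule.map_comp, hgf, Submodule.map_id]
    have h2 : (E.map g).map f = E := by
      rw [← Submodule.map_comp, hfg, Submodule.map_id]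
    rcases hD.eq_bot_or_eq _ (isSubcoalgebra_map hE hg) h1 with h | h
    · left
      rw [← h2, h, Submodule.map_bot]
    · right
      rw [← h2, h]

theorem isSimpleSubcoalgebra_span_singleton {g : C} (hg : IsGroupLikeElem k g) :
    IsSimpleSubcoalgebra (Submodule.span k {g}) where
  isSubcoalgebra x hx := by
    obtain ⟨c, rfl⟩ := Submodule.mem_span_singleton.1 hx
    refine ⟨c • ⟨g, Submodule.mem_span_singleton_self g⟩ ⊗ₜ
      ⟨g, Submodule.mem_span_singleton_self g⟩, ?_⟩
    simp [hg.comul_eq_tmul_self]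
  ne_bot := by
    rw [Ne, Submodule.span_singleton_eq_bot]
    exact hg.ne_zero
  eq_bot_or_eq E _ hE := (nonzero_span_atom g hg.ne_zero).le_iff.1 hE

end Cosemisimple

/-! ### Integrals on H and on K_H, and the coinvariants of K_H -/

section GroupLikes

open Coalgebra HopfAlgebra

variable {k : Type*} {H : Type*} [Field k] [Ring H] [HopfAlgebra k H]

/-- The Haar functional of a cosemisimple Hopf algebra. -/
theorem IsCosemisimple.exists_integral (hcs : IsCosemisimple k H) :
    ∃ h : H →ₗ[k] k, IsNormalisedIntegral h := by
  obtain ⟨h, hh⟩ := hcs.exists_functional {Submodule.span k {(1 : H)}}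
  have hs := isSimpleSubcoalgebra_span_singleton (IsGroupLikeElem.one (R := k) (A := H))
  have h1 : h 1 = 1 := by
    rw [(hh _ hs).1 rfl 1 (Submodule.mem_span_singleton_self 1), Bialgebra.counit_one]
  refine ⟨h, h1, fun y => ?_⟩
  have : (TensorProduct.rid k H).toLinearMap ∘ₗ h.lTensor H ∘ₗ comul =
      h.smulRight (1 : H) := by
    refine hcs.linearMap_ext fun D hD x hx => ?_
    change TensorProduct.rid k H (h.lTensor H (comul x)) = h x • (1 : H)
    -- On k1 the identity is immediate. On any other simple D both sides vanish, since Δ(D) ⊆ D ⊗ D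
    -- and `h` is zero on D.
    by_cases hD1 : D = Submodule.span k {(1 : H)}
    · subst hD1
      obtain ⟨c, rfl⟩ := Submodule.mem_span_singleton.1 hx
      simp [h1, Algebra.TensorProduct.one_def]
    · have h0 := (hh D hD).2 hD1
      rw [hD.isSubcoalgebra.rid_lTensor_eq_zero h0 hx, h0 x hx, zero_smul]
  exact LinearMap.congr_fun this y

theorem comul_mulLeft {g : H} (hg : IsGroupLikeElem k g) (x : H) :
    comul (R := k) (LinearMap.mulLeft k g x) =
      TensorProduct.map (LinearMap.mulLeft k g) (LinearMap.mulLeft k g) (comul x) := by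
  rw [LinearMap.mulLeft_apply, Bialgebra.comul_mul, hg.comul_eq_tmul_self]
  induction comul (R := k) x with
  | zero => simp
  | add x y hx hy => simp only [map_add, mul_add, hx, hy]
  | tmul x y => simp

variable (k H) in
theorem toSubmodule_groupLikeAlgebra :
    Subalgebra.toSubmodule (groupLikeAlgebra k H) =
      Submodule.span k {g : H | IsGroupLikeElem k g} := by
  apply le_antisymm
  · rintro _ ⟨x, rfl⟩
    induction x using MonoidAlgebra.induction_on with
    | of g => exact Submodule.subset_span (by simp)
    | add x y hx hy => simpa only [map_add] using add_mem hx hy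
    | smul c x hx =>
      change MonoidAlgebra.lift k H _ (GroupLike.valMonoidHom k H) (c • x) ∈ _
      rw [map_smul]
      exact Submodule.smul_mem _ c hx
  · rw [Submodule.span_le]
    intro g hg
    exact ⟨MonoidAlgebra.of k _ (⟨g, hg⟩ : GroupLike k H), by simp⟩

/-- A functional `η` which is the counit on the span of the grouplike elements and vanishes on the
other simple subcoalgebras. -/
structure IsGroupLikeProjection (η : H →ₗ[k] k) : Prop where
  apply_groupLike : ∀ g, IsGroupLikeElem k g → η g = 1
  mul_left : ∀ g, IsGroupLikeElem k g → ∀ x, η (g * x) = η x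
  rid_lTensor_comul_mem : ∀ x, TensorProduct.rid k H (η.lTensor H (comul x)) ∈
    Submodule.span k {g : H | IsGroupLikeElem k g}
  counit_rid_lTensor_comul : ∀ x,
    counit (R := k) (TensorProduct.rid k H (η.lTensor H (comul x))) = η x

/-- Left multiplication by a grouplike element permutes the lines spanned by grouplikes, hence also
the remaining simple subcoalgebras; this gives invariance. The map x ↦ x₁ η(x₂) is the identity on
these lines and zero on the other simple subcoalgebras. -/
theorem IsCosemisimple.exists_groupLikeProjection (hcs : IsCosemisimple k H) :
    ∃ η : H →ₗ[k] k, IsGroupLikeProjection η := by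
  let T : Set (Submodule k H) := {D | ∃ g, IsGroupLikeElem k g ∧ D = Submodule.span k {g}}
  obtain ⟨η, hη⟩ := hcs.exists_functional T
  have hη1 : ∀ g, IsGroupLikeElem k g → η g = 1 := fun g hg => by
    rw [(hη _ (isSimpleSubcoalgebra_span_singleton hg)).1 ⟨g, hg, rfl⟩ g
      (Submodule.mem_span_singleton_self g), hg.counit_eq_one]
  refine ⟨η, hη1, fun g hg x => ?_, fun x => ?_, fun x => ?_⟩
  · have : η ∘ₗ LinearMap.mulLeft k g = η := by
      refine hcs.linearMap_ext fun D hD x hx => ?_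
      by_cases hDT : D ∈ T
      · obtain ⟨g', hg', rfl⟩ := hDT
        obtain ⟨c, rfl⟩ := Submodule.mem_span_singleton.1 hx
        simp [hη1 _ hg', hη1 _ (hg.mul hg')]
      · have hfg : LinearMap.mulLeft k g ∘ₗ LinearMap.mulLeft k (antipode k g) =
            LinearMap.id := by
          ext x
          simp [← mul_assoc, hg.mul_antipode_cancel]
        have hgf : LinearMap.mulLeft k (antipode k g) ∘ₗ LinearMap.mulLeft k g =
            LinearMap.id := by
          ext x
          simp [← mul_assoc, hg.antipode_mul_cancel]
        have hD' := isSimpleSubcoalgebra_map hD (comul_mulLeft hg) (comul_mulLeft hg.antipode)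
          hfg hgf
        have hDT' : D.map (LinearMap.mulLeft k g) ∉ T := by
          rintro ⟨g', hg', h⟩
          refine hDT ⟨_, hg.antipode.mul hg', ?_⟩
          rw [← Submodule.map_id D, ← hgf, Submodule.map_comp, h, Submodule.map_span,
            Set.image_singleton, LinearMap.mulLeft_apply]
        rw [(hη D hD).2 hDT x hx]
        exact (hη _ hD').2 hDT' _ (Submodule.mem_map_of_mem hx)
    exact LinearMap.congr_fun this x
  · let S : Submodule k H := Submodule.span k {g : H | IsGroupLikeElem k g}
    have : (⊤ : Submodule k H) ≤
        S.comap ((TensorProduct.rid k H).toLinearMap ∘ₗ η.lTensor H ∘ₗ comul) := by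
      rw [← hcs.sSup_eq_top]
      refine sSup_le fun D hD x hx => ?_
      change TensorProduct.rid k H (η.lTensor H (comul x)) ∈ S
      by_cases hDT : D ∈ T
      · rw [hD.isSubcoalgebra.rid_lTensor_eq_self ((hη D hD).1 hDT) hx]
        obtain ⟨g, hg, rfl⟩ := hDT
        exact Submodule.span_mono (Set.singleton_subset_iff.2 hg) hx
      · rw [hD.isSubcoalgebra.rid_lTensor_eq_zero ((hη D hD).2 hDT) hx]
        exact zero_mem _
    exact this (Submodule.mem_top (x := x))
  · have : ∀ t : H ⊗[k] H, counit (R := k) (TensorProduct.rid k H (η.lTensor H t)) =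
        η (TensorProduct.lid k H ((counit (R := k) (A := H)).rTensor H t)) := by
      intro t
      induction t with
      | zero => simp
      | add x y hx hy => simp only [map_add, hx, hy]
      | tmul x y => simp [mul_comm]
    rw [this]
    simp

theorem projK_surjective : Function.Surjective (projK k H) :=
  Ideal.Quotient.mk_surjective

theorem projK_eq_zero {x : H} : projK k H x = 0 ↔ x ∈ groupLikeIdeal k H :=
  Ideal.Quotient.eq_zero_iff_mem

theorem projK_groupLike {g : H} (hg : IsGroupLikeElem k g) : projK k H g = 1 := by
  rw [← sub_eq_zero, ← map_one (projK k H), ← map_sub, projK_eq_zero]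
  exact sub_one_mem_groupLikeIdeal hg

theorem IsGroupLikeProjection.apply_eq_zero {η : H →ₗ[k] k} (hη : IsGroupLikeProjection η)
    (hΓ : ∀ g : H, IsGroupLikeElem k g → g ∈ Subalgebra.center k H) {x : H}
    (hx : x ∈ groupLikeIdeal k H) : η x = 0 := by
  -- J is the largest two-sided ideal inside ker η. It contains g - 1, because z(g - 1)w = g(zw) -
  -- zw when g is central.
  let J : Ideal H :=
    { carrier := {x | ∀ z w, η (z * x * w) = 0}
      add_mem' := fun {x y} hx hy z w => by rw [mul_add, add_mul, map_add, hx, hy, add_zero]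
      zero_mem' := by simp
      smul_mem' := fun a x hx z w => by
        rw [smul_eq_mul, ← mul_assoc]
        exact hx (z * a) w }
  have : J.IsTwoSided := ⟨fun {x} b hx z w => by
    rw [← mul_assoc, mul_assoc]
    exact hx z (b * w)⟩
  have hJ : groupLikeIdeal k H ≤ J := groupLikeIdeal_le k fun g hg z w => by
    have h1 : z * g = g * z := ((Subalgebra.mem_center_iff.1 (hΓ g hg)) z)
    rw [mul_sub, mul_one, sub_mul, map_sub, h1, mul_assoc, hη.mul_left g hg, sub_self]
  simpa using hJ hx 1 1

/-- The functional induced on `K_H` is a normalised integral. -/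
theorem IsGroupLikeProjection.exists_integral {η : H →ₗ[k] k} (hη : IsGroupLikeProjection η)
    (hΓ : ∀ g : H, IsGroupLikeElem k g → g ∈ Subalgebra.center k H) :
    ∃ h : KQuot k H →ₗ[k] k, IsNormalisedIntegral h ∧ ∀ x, h (projK k H x) = η x := by
  let p : H →ₗ[k] KQuot k H := (projK k H : H →ₐ[k] KQuot k H).toLinearMap
  obtain ⟨σ, hσ⟩ := p.exists_rightInverse_of_surjective (LinearMap.range_eq_top.2 projK_surjective)
  -- `η` factors through K_H, so the choice of the linear section σ does not matter.
  have hp : ∀ x, η (σ (p x)) = η x := by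
    intro x
    rw [← sub_eq_zero, ← map_sub]
    refine hη.apply_eq_zero hΓ (projK_eq_zero.1 ?_)
    rw [map_sub, sub_eq_zero]
    exact LinearMap.congr_fun hσ (p x)
  refine ⟨η ∘ₗ σ, ⟨?_, fun y => ?_⟩, hp⟩
  · have := hp 1
    rw [hη.apply_groupLike 1 .one, show p 1 = 1 from map_one (projK k H)] at this
    exact this
  · obtain ⟨x, rfl⟩ := projK_surjective y
    have h1 : comul (R := k) (projK k H x) = TensorProduct.map p p (comul x) :=
      (CoalgHomClass.map_comp_comul_apply (projK k H) x).symm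
    have h2 : ∀ t : H ⊗[k] H, TensorProduct.rid k (KQuot k H) ((η ∘ₗ σ).lTensor (KQuot k H)
        (TensorProduct.map p p t)) = p (TensorProduct.rid k H (η.lTensor H t)) := by
      intro t
      induction t with
      | zero => simp
      | add x y hx hy => simp only [map_add, hx, hy]
      | tmul x y => simp [hp]
    -- x₁ η(x₂) lies in the span of the grouplikes, all of which map to 1 in K_H, so its image is
    -- the scalar given by its counit, namely η(x).
    have h3 : ∀ z ∈ Submodule.span k {g : H | IsGroupLikeElem k g},
        p z = counit (R := k) z • (1 : KQuot k H) := by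
      intro z hz
      induction hz using Submodule.span_induction with
      | mem g hg => rw [hg.counit_eq_one, one_smul]; exact projK_groupLike hg
      | zero => simp
      | add x y _ _ hx hy => simp only [map_add, add_smul, hx, hy]
      | smul c x _ hx => simp only [map_smul, hx, smul_assoc]
    rw [h1, h2, h3 _ (hη.rid_lTensor_comul_mem x), hη.counit_rid_lTensor_comul]
    exact congrArg (· • (1 : KQuot k H)) (hp x).symm

/-- S⁻¹ also preserves the defining ideal, since S⁻¹(g) = S(g) for g grouplike, so it descends to an
inverse of the antipode of K_H. -/
theorem antipode_projK_bijective (hH : Function.Bijective (antipode k (A := H))) :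
    Function.Bijective (antipode k (A := KQuot k H)) := by
  let J : Ideal H :=
    { carrier := {x | antipodeInv hH x ∈ groupLikeIdeal k H}
      add_mem' := fun {x y} hx hy => by
        change antipodeInv hH (x + y) ∈ groupLikeIdeal k H
        rw [map_add]
        exact add_mem hx hy
      zero_mem' := by simp
      smul_mem' := fun a x hx => by
        have h1 : antipodeInv hH (a * x) = antipodeInv hH x * antipodeInv hH a :=
          hH.1 (by simp only [antipode_mul_antidistrib, antipode_antipodeInv])
        change antipodeInv hH (a * x) ∈ groupLikeIdeal k H
        rw [h1]
        exact Ideal.mul_mem_right _ _ hx }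
  have : J.IsTwoSided := ⟨fun {x} b hx => by
    have h1 : antipodeInv hH (x * b) = antipodeInv hH b * antipodeInv hH x :=
      hH.1 (by simp only [antipode_mul_antidistrib, antipode_antipodeInv])
    change antipodeInv hH (x * b) ∈ groupLikeIdeal k H
    rw [h1]
    exact Ideal.mul_mem_left _ _ hx⟩
  have hJ : groupLikeIdeal k H ≤ J := groupLikeIdeal_le k fun g hg => by
    have h1 : antipodeInv hH (g - 1) = antipode k g - 1 :=
      hH.1 (by rw [antipode_antipodeInv, map_sub, hg.antipode_antipode, antipode_one])
    change antipodeInv hH (g - 1) ∈ groupLikeIdeal k H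
    rw [h1]
    exact sub_one_mem_groupLikeIdeal hg.antipode
  constructor
  · rw [injective_iff_map_eq_zero]
    intro y hy
    obtain ⟨x, rfl⟩ := projK_surjective y
    rw [← map_antipode, projK_eq_zero] at hy
    have h1 : antipodeInv hH (antipode k x) ∈ groupLikeIdeal k H := hJ hy
    rw [show antipodeInv hH (antipode k x) = x from hH.1 (antipode_antipodeInv hH _)] at h1
    exact projK_eq_zero.2 h1
  · intro y
    obtain ⟨x, rfl⟩ := projK_surjective y
    exact ⟨projK k H (antipodeInv hH x), by rw [← map_antipode, antipode_antipodeInv]⟩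

/-- Applying the integral of K_H to the second leg of x₁ ⊗ p(x₂) = x ⊗ 1 gives x = x₁ η(x₂), which
lies in the span of the grouplikes. Conversely p(g) = 1 makes each grouplike coinvariant. -/
theorem coinvariants_projK {η : H →ₗ[k] k} (hη : IsGroupLikeProjection η)
    (hΓ : ∀ g : H, IsGroupLikeElem k g → g ∈ Subalgebra.center k H) :
    coinvariants (projK k H) = groupLikeAlgebra k H := by
  obtain ⟨h, hh, hhη⟩ := hη.exists_integral hΓ
  apply Subalgebra.toSubmodule_injective
  rw [toSubmodule_groupLikeAlgebra]
  apply le_antisymm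
  · intro x hx
    have h1 : ∀ t : H ⊗[k] H, TensorProduct.rid k H (h.lTensor H
        ((projK k H : H →ₐ[k] KQuot k H).toLinearMap.lTensor H t)) =
        TensorProduct.rid k H (η.lTensor H t) := by
      intro t
      induction t with
      | zero => simp
      | add x y hx hy => simp only [map_add, hx, hy]
      | tmul x y => simp [hhη]
    have h2 := h1 (comul x)
    rw [← rightCoaction_apply, mem_coinvariants.1 hx] at h2
    have h3 := hη.rid_lTensor_comul_mem x
    rw [← h2] at h3
    simpa [hh.map_one] using h3
  · rw [Submodule.span_le]
    intro g hg
    change g ∈ coinvariants (projK k H)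
    rw [mem_coinvariants, rightCoaction_apply, IsGroupLikeElem.comul_eq_tmul_self hg]
    simp [projK_groupLike hg]

end GroupLikes

/-! ### Principal pairs from a tower A → H → K -/

section PrincipalPairs

open Coalgebra HopfAlgebra

variable {k : Type*} [Field k] {A : Type u} {H : Type v} {K : Type*} [Ring A] [HopfAlgebra k A]
  [Ring H] [HopfAlgebra k H] [Ring K] [HopfAlgebra k K]

theorem reynolds_eq_self {h : H →ₗ[k] k} (hh : IsNormalisedIntegral h) {π : A →ₐc[k] H} {a : A}
    (ha : a ∈ coinvariants π) : reynolds π h a = a := by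
  rw [← one_mul a, reynolds_mul π h 1 ha, reynolds_one hh]

theorem rTensor_rightCoaction_comp (π : A →ₐc[k] H) (q : H →ₐc[k] K) (a : A) :
    (π : A →ₐ[k] H).toLinearMap.rTensor K (rightCoaction (q.comp π) a) =
      rightCoaction q (π a) := by
  have h1 : comul (R := k) (π a) = TensorProduct.map (π : A →ₐ[k] H).toLinearMap
      (π : A →ₐ[k] H).toLinearMap (comul a) :=
    (CoalgHomClass.map_comp_comul_apply π a).symm
  rw [rightCoaction_apply, rightCoaction_apply, h1]
  induction comul (R := k) a with
  | zero => simp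
  | add x y hx hy => simp only [map_add, hx, hy]
  | tmul x y => simp

theorem map_reynolds (π : A →ₐc[k] H) (q : H →ₐc[k] K) (h : K →ₗ[k] k) (a : A) :
    π (reynolds (q.comp π) h a) = reynolds q h (π a) := by
  have h1 : ∀ t : A ⊗[k] K, π (TensorProduct.rid k A (h.lTensor A t)) =
      TensorProduct.rid k H (h.lTensor H ((π : A →ₐ[k] H).toLinearMap.rTensor K t)) := by
    intro t
    induction t with
    | zero => simp
    | add x y hx hy => simp only [map_add, hx, hy]
    | tmul x y => simp
  refine (h1 _).trans ?_
  rw [AlgHom.toLinearMap_apply, rTensor_rightCoaction_comp]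
  rfl

theorem map_mem_coinvariants (π : A →ₐc[k] H) (q : H →ₐc[k] K) {a : A}
    (ha : a ∈ coinvariants (q.comp π)) : π a ∈ coinvariants q := by
  rw [mem_coinvariants, ← rTensor_rightCoaction_comp, mem_coinvariants.1 ha]
  rfl

/-- An arbitrary lift of a coinvariant is made coinvariant by the Reynolds operator of A. Its image
is unchanged, since `π` intertwines the two Reynolds operators and that of H fixes coinvariants. -/
theorem map_coinvariants_comp {π : A →ₐc[k] H} (hπ : Function.Surjective π) (q : H →ₐc[k] K)
    {h : K →ₗ[k] k} (hh : IsNormalisedIntegral h) :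
    (coinvariants (q.comp π)).map (π : A →ₐ[k] H) = coinvariants q := by
  apply le_antisymm
  · rintro _ ⟨a, ha, rfl⟩
    exact map_mem_coinvariants π q ha
  · intro x hx
    obtain ⟨a, rfl⟩ := hπ x
    refine ⟨reynolds (q.comp π) h a, reynolds_mem hh _ a, ?_⟩
    exact (map_reynolds π q h a).trans (reynolds_eq_self hh hx)

theorem coinvariants_le_coinvariants_comp (π : A →ₐc[k] H) (q : H →ₐc[k] K) :
    coinvariants π ≤ coinvariants (q.comp π) := by
  intro a ha
  have h1 : ∀ t : A ⊗[k] A, (q.comp π : A →ₐ[k] K).toLinearMap.lTensor A t =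
      (q : H →ₐ[k] K).toLinearMap.lTensor A ((π : A →ₐ[k] H).toLinearMap.lTensor A t) := by
    intro t
    induction t with
    | zero => simp
    | add x y hx hy => simp only [map_add, hx, hy]
    | tmul x y => rfl
  rw [mem_coinvariants, rightCoaction_apply, h1, ← rightCoaction_apply, mem_coinvariants.1 ha]
  simp

/-- A subalgebra spanned by grouplike elements with inverses in it is a Hopf subalgebra. -/
theorem isHopfSubalgebra_of_le_span (D : Subalgebra k H)
    (hD : Subalgebra.toSubmodule D ≤
      Submodule.span k {x : H | IsGroupLikeElem k x ∧ x ∈ D ∧ antipode k x ∈ D}) :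
    IsHopfSubalgebra D where
  isSubcoalgebra := by
    have : Subalgebra.toSubmodule D ≤ (LinearMap.range (TensorProduct.map
        (Subalgebra.toSubmodule D).subtype (Subalgebra.toSubmodule D).subtype)).comap comul := by
      refine hD.trans (Submodule.span_le.2 fun g hg => ?_)
      exact ⟨⟨g, hg.2.1⟩ ⊗ₜ ⟨g, hg.2.1⟩, hg.1.comul_eq_tmul_self.symm⟩
    exact this
  antipode_mem := by
    have : Subalgebra.toSubmodule D ≤ (Subalgebra.toSubmodule D).comap (antipode k) :=
      hD.trans (Submodule.span_le.2 fun g hg => hg.2.2)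
    exact this

/-- The isomorphism `π_B(A) → H` for `B = A^{co(H)}` as an algebra map. -/
noncomputable def fiberMap {B : Subalgebra k A} [IsQuantumHomogeneousSpace B] (π : A →ₐc[k] H)
    (hπB : ∀ a, a ∈ augIdeal B ↔ π a = 0) : FiberHopf B →ₐ[k] H :=
  Ideal.Quotient.liftₐ (augIdeal B) (π : A →ₐ[k] H) fun a ha => (hπB a).1 ha

section fiberMap

variable {B : Subalgebra k A} [IsQuantumHomogeneousSpace B] {π : A →ₐc[k] H}

theorem proj_surjective : Function.Surjective (proj B) :=
  Ideal.Quotient.mk_surjective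

theorem fiberMap_injective (hπB : ∀ a, a ∈ augIdeal B ↔ π a = 0) :
    Function.Injective (fiberMap π hπB) := by
  rw [injective_iff_map_eq_zero]
  intro x hx
  obtain ⟨a, rfl⟩ := proj_surjective x
  exact Ideal.Quotient.eq_zero_iff_mem.2 ((hπB a).2 hx)

/-- The comultiplication identity may be checked after the injection `e ⊗ e` into H ⊗ H, where it is
the one for `π a`. -/
theorem isGroupLikeElem_proj (hπB : ∀ a, a ∈ augIdeal B ↔ π a = 0) {a : A}
    (ha : IsGroupLikeElem k (π a)) :
    IsGroupLikeElem k (proj B a) where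
  counit_eq_one := by
    rw [← ha.counit_eq_one]
    exact (CoalgHomClass.counit_comp_apply (proj B) a).trans
      (CoalgHomClass.counit_comp_apply π a).symm
  comul_eq_tmul_self := by
    let e : FiberHopf B →ₗ[k] H := (fiberMap π hπB).toLinearMap
    have he : Function.Injective (TensorProduct.map e e) :=
      TensorProduct.map_injective_of_flat_flat e e (fiberMap_injective hπB) (fiberMap_injective hπB)
    apply he
    have h1 : comul (R := k) (proj B a) = TensorProduct.map (proj B : A →ₐ[k] FiberHopf B).toLinearMap
        (proj B : A →ₐ[k] FiberHopf B).toLinearMap (comul a) :=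
      (CoalgHomClass.map_comp_comul_apply (proj B) a).symm
    have h2 : comul (R := k) (π a) = TensorProduct.map (π : A →ₐ[k] H).toLinearMap
        (π : A →ₐ[k] H).toLinearMap (comul a) :=
      (CoalgHomClass.map_comp_comul_apply π a).symm
    rw [h1, ← LinearMap.comp_apply, ← TensorProduct.map_comp]
    exact h2.symm.trans ha.comul_eq_tmul_self

/-- The injections of the fibres into H and K carry the coaction on π_B(A) to the one on H, so
coinvariance may be tested in H. -/
theorem proj_mem_coinvariants_iff (hπB : ∀ a, a ∈ augIdeal B ↔ π a = 0)
    {P : Subalgebra k A} [IsQuantumHomogeneousSpace P]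
    (hle : B ≤ P) {q : H →ₐc[k] K} (hπP : ∀ a, a ∈ augIdeal P ↔ q.comp π a = 0) (a : A) :
    proj B a ∈ coinvariants (projOfLE hle) ↔ π a ∈ coinvariants q := by
  let e : FiberHopf B →ₗ[k] H := (fiberMap π hπB).toLinearMap
  let e' : FiberHopf P →ₗ[k] K := (fiberMap (q.comp π) hπP).toLinearMap
  have he : Function.Injective (TensorProduct.map e e') :=
    TensorProduct.map_injective_of_flat_flat e e' (fiberMap_injective hπB) (fiberMap_injective hπP)
  have h1 : comul (R := k) (proj B a) = TensorProduct.map (proj B : A →ₐ[k] FiberHopf B).toLinearMap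
      (proj B : A →ₐ[k] FiberHopf B).toLinearMap (comul a) :=
    (CoalgHomClass.map_comp_comul_apply (proj B) a).symm
  have h2 : comul (R := k) (π a) = TensorProduct.map (π : A →ₐ[k] H).toLinearMap
      (π : A →ₐ[k] H).toLinearMap (comul a) :=
    (CoalgHomClass.map_comp_comul_apply π a).symm
  have h3 : TensorProduct.map e e' (rightCoaction (projOfLE hle) (proj B a)) =
      rightCoaction q (π a) := by
    rw [rightCoaction_apply, rightCoaction_apply, h1, h2]
    induction comul (R := k) a with
    | zero => simp
    | add x y hx hy => simp only [map_add, hx, hy]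
    | tmul x y => rfl
  have h4 : TensorProduct.map e e' (proj B a ⊗ₜ 1) = π a ⊗ₜ 1 := by
    rw [TensorProduct.map_tmul]
    exact congrArg (π a ⊗ₜ ·) (map_one (fiberMap (q.comp π) hπP))
  rw [mem_coinvariants, mem_coinvariants, ← h3, ← h4, he.eq_iff]

end fiberMap

theorem isPrincipalPair_coinvariants (hA : Function.Bijective (antipode k (A := A)))
    (hH : Function.Bijective (antipode k (A := H))) (hK : Function.Bijective (antipode k (A := K)))
    {π : A →ₐc[k] H} (hπ : Function.Surjective π) {q : H →ₐc[k] K} (hq : Function.Surjective q)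
    {h : H →ₗ[k] k} (hh : IsNormalisedIntegral h) {h' : K →ₗ[k] k} (hh' : IsNormalisedIntegral h')
    (hΓ : coinvariants q = groupLikeAlgebra k H) :
    IsPrincipalPair (coinvariants π) (coinvariants (q.comp π)) := by
  have hqπ : Function.Surjective (q.comp π) := hq.comp hπ
  have iB := isQuantumHomogeneousSpace_coinvariants hA hH hπ hh
  have iP := isQuantumHomogeneousSpace_coinvariants hA hK hqπ hh'
  have hle := coinvariants_le_coinvariants_comp π q
  have hB := fun a => mem_augIdeal_coinvariants (a := a) hA hH hπ hh
  have hP := fun a => mem_augIdeal_coinvariants (a := a) hA hK hqπ hh'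
  have hmem : ∀ a, proj (coinvariants π) a ∈ (coinvariants (q.comp π)).map
      (proj (coinvariants π) : A →ₐ[k] FiberHopf (coinvariants π)) ↔ π a ∈ coinvariants q := by
    intro a
    rw [← map_coinvariants_comp hπ q hh']
    constructor
    · rintro ⟨p, hp, hpa⟩
      exact ⟨p, hp, congrArg (fiberMap π hB) hpa⟩
    · rintro ⟨p, hp, hpa⟩
      exact ⟨p, hp, fiberMap_injective hB hpa⟩
  refine ⟨iB, iP, hle, ?_, ?_⟩
  · ext x
    obtain ⟨a, rfl⟩ := proj_surjective x
    rw [hmem, proj_mem_coinvariants_iff hB hle hP]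
  -- The span of the grouplikes of H is lifted to the fibre term by term. The lift found may differ
  -- from the given element of A, but injectivity of `fiberMap` makes their classes equal.
  · have hlift : ∀ y ∈ Submodule.span k {g : H | IsGroupLikeElem k g}, ∃ a, π a = y ∧
        proj (coinvariants π) a ∈ Submodule.span k {x : FiberHopf (coinvariants π) |
          IsGroupLikeElem k x ∧ x ∈ (coinvariants (q.comp π)).map
            (proj (coinvariants π) : A →ₐ[k] FiberHopf (coinvariants π)) ∧
          antipode k x ∈ (coinvariants (q.comp π)).map
            (proj (coinvariants π) : A →ₐ[k] FiberHopf (coinvariants π))} := by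
      have hgl : ∀ g : H, IsGroupLikeElem k g → g ∈ coinvariants q := fun g hg => by
        rw [hΓ, ← Subalgebra.mem_toSubmodule, toSubmodule_groupLikeAlgebra]
        exact Submodule.subset_span hg
      intro y hy
      induction hy using Submodule.span_induction with
      | mem g hg =>
        obtain ⟨a, rfl⟩ := hπ g
        refine ⟨a, rfl, Submodule.subset_span ⟨isGroupLikeElem_proj hB hg,
          (hmem a).2 (hgl _ hg), ?_⟩⟩
        rw [← map_antipode, hmem, map_antipode]
        exact hgl _ (IsGroupLikeElem.antipode hg)
      | zero => exact ⟨0, by simp⟩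
      | add x y _ _ hx hy =>
        obtain ⟨a, rfl, ha⟩ := hx
        obtain ⟨b, rfl, hb⟩ := hy
        exact ⟨a + b, map_add π a b, by rw [map_add]; exact add_mem ha hb⟩
      | smul c x _ hx =>
        obtain ⟨a, rfl, ha⟩ := hx
        exact ⟨c • a, map_smul π c a, by rw [map_smul]; exact Submodule.smul_mem _ c ha⟩
    refine isHopfSubalgebra_of_le_span _ fun x hx => ?_
    obtain ⟨a, rfl⟩ := proj_surjective x
    have h1 : π a ∈ Submodule.span k {g : H | IsGroupLikeElem k g} := by
      rw [← toSubmodule_groupLikeAlgebra, ← hΓ]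
      exact (hmem a).1 hx
    obtain ⟨b, hb, hb'⟩ := hlift _ h1
    rwa [show proj (coinvariants π) a = proj (coinvariants π) b from
      fiberMap_injective hB hb.symm]

end PrincipalPairs

end QHS

theorem theorem4 {A : Type u} {H : Type v} [Ring A] [HopfAlgebra ℂ A] [Ring H] [HopfAlgebra ℂ H]
    (hA : Function.Bijective (HopfAlgebra.antipode ℂ (A := A)))
    (hH : Function.Bijective (HopfAlgebra.antipode ℂ (A := H)))
    (π : A →ₐc[ℂ] H) (hπ : Function.Surjective π)
    (hcs : QHS.IsCosemisimple ℂ H)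
    (hΓ : ∀ g : H, IsGroupLikeElem ℂ g → g ∈ Subalgebra.center ℂ H) :
    (QHS.coinvariants ((QHS.projK ℂ H).comp π)).map (π : A →ₐ[ℂ] H) =
        QHS.coinvariants (QHS.projK ℂ H) ∧
      QHS.coinvariants (QHS.projK ℂ H) = QHS.groupLikeAlgebra ℂ H ∧
      QHS.IsPrincipalPair (QHS.coinvariants π) (QHS.coinvariants ((QHS.projK ℂ H).comp π)) := by
  obtain ⟨h, hh⟩ := hcs.exists_integral
  obtain ⟨η, hη⟩ := hcs.exists_groupLikeProjection
  obtain ⟨h', hh', -⟩ := hη.exists_integral hΓ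
  have hco := QHS.coinvariants_projK hη hΓ
  exact ⟨QHS.map_coinvariants_comp hπ _ hh', hco,
    QHS.isPrincipalPair_coinvariants hA hH (QHS.antipode_projK_bijective (H := H) hH) hπ
      QHS.projK_surjective hh hh' hco⟩
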